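/- **Setting.** Let $A_0, A^\star\in\mathbb R^{d_y\times d_x}$ and $\Delta^\star = A^\star-A_0$. Let $P_x$ be a probability distribution on $\mathbb R^{d_x}$ with finite second moments such that $\Sigma_{xx}=\mathbb E[xx^\top]$ has full rank, and let $\Sigma_{\varepsilon\varepsilon}\in\mathbb R^{d_y\times d_y}$ be positive semidefinite. Let $\mathbb P_{x,y}$ be the law of $(x,y)$ with $y=A^\star x+\varepsilon$, where $x\sim P_x$ and $\varepsilon\sim\mathcal N(0,\Sigma_{\varepsilon\varepsilon})$ are independent. The training set consists of $n$ i.i.d. samples $(x_i,y_i)\sim\mathbb P_{x,y}$; put $X=[x_1,\dots,x_n]$, $Y=[y_1,\dots,y_n]$ and $\widehat\Sigma_{xx}=\frac1n XX^\top$. Let ${}^\dagger$ denote the Moore--Penrose inverse, $\|\cdot\|_F$ the Frobenius norm, $\lambda_{\max}$ the largest eigenvalue, and $P_X^\perp=I-XX^\dagger$ the orthogonal projection onto the orthogonal complement of the column space of $X$. The rank-$r$ LoRA estimator is $$\widehat A_{\mathrm{LoRA}}=A_0+\big[\widehat\Delta_{\mathrm{FFT}}\,\widehat\Sigma_{xx}^{1/2}\big]_r\big(\widehat\Sigma_{xx}^{1/2}\big)^\dagger,\qquad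 \widehat\Delta_{\mathrm{FFT}}=(Y-A_0X)X^\dagger,$$ where $[M]_r$ denotes a rank-$r$ singular value truncation of $M$ (the sum of the first $r$ terms, or of all terms if there are fewer than $r$, of a singular value decomposition of $M$ with non-increasing singular values; any choice is allowed where it is not unique). The population risk of a fixed matrix $A$ is $\mathcal R(A)=\mathbb E_{(x,y)\sim\mathbb P_{x,y}}\|Ax-y\|^2$. **Statement.** There is an absolute constant $C>0$ such that, in the above setting, whenever $\operatorname{rank}(\Delta^\star)\le r<n<d_x$, $$\mathbb E\big[\mathcal R(\widehat A_{\mathrm{LoRA}})\big]-\mathcal R(A^\star)\;\le\; C\left(\mathbb E\Big[\big\|\Delta^\star P_X^\perp\Sigma_{xx}^{1/2}\big\|_F^2\Big]+\frac{r\max\{n,d_y\}}{n}\,\lambda_{\max}(\Sigma_{\varepsilon\varepsilon})\;\mathbb E\Big[\lambda_{\max}\big(\Sigma_{xx}\widehat\Sigma_{xx}^\dagger\big)\Big]\right),$$ where the expectations are over the training set and take values in $[0,\infty]$, with the convention $0\cdot\infty=0$. -/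

import Mathlib

open MeasureTheory ProbabilityTheory
open scoped ENNReal NNReal

noncomputable section

namespace LoRA

/-! ### Matrix notions -/

section MatrixNotions

open scoped MatrixOrder in
/-- The positive semidefinite square root `S^{1/2}` of a positive semidefinite matrix `S`. -/
def psdSqrt {d : ℕ} (S : Matrix (Fin d) (Fin d) ℝ) : Matrix (Fin d) (Fin d) ℝ :=
  CFC.sqrt S

/-- The Moore--Penrose inverse `A† = (Aᵀ A)† Aᵀ` of a real matrix. The pseudoinverse of the
symmetric matrix `Aᵀ A` is obtained by inverting its nonzero eigenvalues (in Lean `0⁻¹ = 0`).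
The four Penrose equations, which characterise `A†`, are proved in `isMoorePenrose_pinv`. -/
def pinv {p q : ℕ} (A : Matrix (Fin p) (Fin q) ℝ) : Matrix (Fin q) (Fin p) ℝ :=
  cfc (fun t : ℝ => t⁻¹) (A.transpose * A) * A.transpose

/-- The four Penrose equations. -/
def IsMoorePenrose {p q : ℕ} (A : Matrix (Fin p) (Fin q) ℝ) (B : Matrix (Fin q) (Fin p) ℝ) :
    Prop :=
  A * B * A = A ∧ B * A * B = B ∧ (A * B).transpose = A * B ∧ (B * A).transpose = B * A

/-- The squared Frobenius norm. -/
def frobSq {p q : ℕ} (A : Matrix (Fin p) (Fin q) ℝ) : ℝ :=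
  ∑ i, ∑ j, A i j ^ 2

/-- The largest real eigenvalue of a square matrix. It is only used for positive semidefinite
matrices and for products of two such matrices, whose eigenvalues are all real. -/
def lambdaMax {d : ℕ} (A : Matrix (Fin d) (Fin d) ℝ) : ℝ :=
  sSup (spectrum ℝ A)

/-- `T` is a rank-`r` singular value truncation of `M`: for some singular value decomposition
`M = ∑ᵢ σᵢ uᵢ vᵢᵀ` with `σ₀ ≥ σ₁ ≥ … ≥ 0`, the matrix `T` is the sum of the first `r` terms
(all the terms if there are fewer than `r`). -/
def IsTruncation {p q : ℕ} (r : ℕ) (M T : Matrix (Fin p) (Fin q) ℝ) : Prop :=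
  ∃ (σ : Fin (min p q) → ℝ) (u : Fin (min p q) → EuclideanSpace ℝ (Fin p))
    (v : Fin (min p q) → EuclideanSpace ℝ (Fin q)),
    Orthonormal ℝ u ∧ Orthonormal ℝ v ∧ Antitone σ ∧ (∀ i, 0 ≤ σ i) ∧
    M = ∑ i, σ i • Matrix.vecMulVec (u i).ofLp (v i).ofLp ∧
    T = ∑ i : Fin (min p q), (if i.val < r then σ i else 0) • Matrix.vecMulVec (u i).ofLp (v i).ofLp

end MatrixNotions

/-! ### The regression model -/

/-- The population second moment matrix `Σ_xx = E[x xᵀ]` of the feature distribution. -/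
def secondMoment {dx : ℕ} (Px : Measure (EuclideanSpace ℝ (Fin dx))) :
    Matrix (Fin dx) (Fin dx) ℝ :=
  Matrix.of fun i j => ∫ x, x i * x j ∂Px

/-- The distribution of one sample `(x, y)`, where `y = A⋆ x + ε` with `x ∼ Px` and
`ε ∼ N(0, Σ_εε)` independent. -/
def sampleLaw {dx dy : ℕ} (Astar : Matrix (Fin dy) (Fin dx) ℝ)
    (Px : Measure (EuclideanSpace ℝ (Fin dx))) (Sε : Matrix (Fin dy) (Fin dy) ℝ) :
    Measure (EuclideanSpace ℝ (Fin dx) × EuclideanSpace ℝ (Fin dy)) :=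
  (Px.prod (multivariateGaussian 0 Sε)).map
    (fun z => (z.1, Matrix.toEuclideanLin Astar z.1 + z.2))

/-- The population risk `R(A) = E ‖A x - y‖²` of a fixed matrix `A`, with `(x, y) ∼ P`. -/
def risk {dx dy : ℕ} (P : Measure (EuclideanSpace ℝ (Fin dx) × EuclideanSpace ℝ (Fin dy)))
    (A : Matrix (Fin dy) (Fin dx) ℝ) : ℝ≥0∞ :=
  ∫⁻ z, ENNReal.ofReal (‖Matrix.toEuclideanLin A z.1 - z.2‖ ^ 2) ∂P

/-- The matrix with columns `c 0, …, c (n - 1)`. -/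
def colMatrix {d n : ℕ} (c : Fin n → EuclideanSpace ℝ (Fin d)) : Matrix (Fin d) (Fin n) ℝ :=
  Matrix.of fun i j => c j i

section TrainingSet

variable {dx dy n : ℕ}
  (D : Fin n → EuclideanSpace ℝ (Fin dx) × EuclideanSpace ℝ (Fin dy))

/-- The feature matrix `X = [x₁, …, xₙ]` of a training set. -/
def featureMatrix : Matrix (Fin dx) (Fin n) ℝ := colMatrix fun i => (D i).1

/-- The label matrix `Y = [y₁, …, yₙ]` of a training set. -/
def labelMatrix : Matrix (Fin dy) (Fin n) ℝ := colMatrix fun i => (D i).2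

/-- The empirical covariance `Σ̂_xx = (1/n) X Xᵀ`. -/
def empCov : Matrix (Fin dx) (Fin dx) ℝ :=
  (1 / (n : ℝ)) • (featureMatrix D * (featureMatrix D).transpose)

/-- The orthogonal projection `P_X^⊥ = I - X X†` onto the orthogonal complement of the column
space of `X`. -/
def projPerp : Matrix (Fin dx) (Fin dx) ℝ :=
  1 - featureMatrix D * pinv (featureMatrix D)

/-- The full fine-tuning update `(Y - A₀ X) X†`. -/
def deltaFFT (A0 : Matrix (Fin dy) (Fin dx) ℝ) : Matrix (Fin dy) (Fin dx) ℝ :=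
  (labelMatrix D - A0 * featureMatrix D) * pinv (featureMatrix D)

/-- `A` is a rank-`r` LoRA solution for the training set `D` and the pre-trained model `A₀`:
`A = A₀ + T (Σ̂_xx^{1/2})†`, where `T` is a rank-`r` singular value truncation of
`Δ_FFT Σ̂_xx^{1/2}`. (It is the only one whenever that truncation is unique.) -/
def IsLoRASolution (r : ℕ) (A0 A : Matrix (Fin dy) (Fin dx) ℝ) : Prop :=
  ∃ T : Matrix (Fin dy) (Fin dx) ℝ,
    IsTruncation r (deltaFFT D A0 * psdSqrt (empCov D)) T ∧
    A = A0 + T * pinv (psdSqrt (empCov D))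

end TrainingSet

/-- The expected excess risk `E[R(Â)] - R(A⋆)` of a random matrix `Â`, in `[0, ∞]`. (`R(A⋆)` is
the finite number `tr Σ_εε` and the smallest value of `R`, so the subtraction is a genuine one.) -/
def expectedExcessRisk {dx dy : ℕ} {Ω : Type*} [MeasurableSpace Ω] (μ : Measure Ω)
    (P : Measure (EuclideanSpace ℝ (Fin dx) × EuclideanSpace ℝ (Fin dy)))
    (Astar : Matrix (Fin dy) (Fin dx) ℝ) (Ahat : Ω → Matrix (Fin dy) (Fin dx) ℝ) : ℝ≥0∞ :=
  (∫⁻ ω, risk P (Ahat ω) ∂μ) - risk P Astar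

/-! ### Sanity of the definitions -/

theorem isMoorePenrose_pinv {p q : ℕ} (A : Matrix (Fin p) (Fin q) ℝ) :
    IsMoorePenrose A (pinv A) := by
  set H : Matrix (Fin q) (Fin q) ℝ := A.transpose * A with hH
  set G : Matrix (Fin q) (Fin q) ℝ := cfc (fun t : ℝ => t⁻¹) H with hG
  have hsa : IsSelfAdjoint H := by
    rw [hH, isSelfAdjoint_iff, Matrix.star_eq_conjTranspose,
      Matrix.conjTranspose_eq_transpose_of_trivial, Matrix.transpose_mul, Matrix.transpose_transpose]
  have hc : ∀ f : ℝ → ℝ, ContinuousOn f (spectrum ℝ H) := fun f =>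
    (Matrix.finite_real_spectrum (A := H)).continuousOn f
  have hid : cfc (fun t : ℝ => t) H = H := cfc_id' ℝ H
  have hHG : H * G = cfc (fun t : ℝ => t * t⁻¹) H := by
    rw [cfc_mul _ _ H (hc _) (hc _), hid]
  have hGH : G * H = cfc (fun t : ℝ => t * t⁻¹) H := by
    conv_lhs => rw [hG]; rhs; rw [← hid]
    rw [← cfc_mul _ _ H (hc _) (hc _)]
    congr 1; ext t; ring
  have hHGH : H * G * H = H := by
    rw [hHG]
    conv_lhs => rhs; rw [← hid]
    rw [← cfc_mul _ _ H (hc _) (hc _)]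
    conv_rhs => rw [← hid]
    congr 1; ext t; exact mul_inv_mul_cancel t
  have hGHG : G * H * G = G := by
    rw [hGH, hG, ← cfc_mul _ _ H (hc _) (hc _)]
    congr 1; ext t
    by_cases ht : t = 0 <;> simp [ht]
  have hGt : G.transpose = G := by
    have : IsSelfAdjoint G := cfc_predicate _ _
    rwa [isSelfAdjoint_iff, Matrix.star_eq_conjTranspose,
      Matrix.conjTranspose_eq_transpose_of_trivial] at this
  have hHt : H.transpose = H := by
    rwa [isSelfAdjoint_iff, Matrix.star_eq_conjTranspose,
      Matrix.conjTranspose_eq_transpose_of_trivial] at hsa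
  have hp : pinv A = G * A.transpose := rfl
  have hAGH : A * G * H = A := by
    have h0 : (A * G * H - A).transpose * (A * G * H - A) = 0 := by
      have e : (A * G * H - A).transpose = (H * G - 1) * A.transpose := by
        simp only [Matrix.transpose_sub, Matrix.transpose_mul, hGt, hHt, Matrix.sub_mul,
          Matrix.one_mul, Matrix.mul_assoc]
      have e2 : A.transpose * (A * G * H - A) = 0 := by
        rw [Matrix.mul_sub, sub_eq_zero]
        calc A.transpose * (A * G * H) = A.transpose * A * G * H := by simp only [Matrix.mul_assoc]
          _ = A.transpose * A := by rw [← hH, hHGH]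
      rw [e, Matrix.mul_assoc, e2, Matrix.mul_zero]
    rw [← Matrix.conjTranspose_eq_transpose_of_trivial,
      Matrix.conjTranspose_mul_self_eq_zero] at h0
    exact sub_eq_zero.mp h0
  refine ⟨?_, ?_, ?_, ?_⟩
  · rw [hp, Matrix.mul_assoc, Matrix.mul_assoc, ← hH, ← Matrix.mul_assoc, hAGH]
  · rw [hp]
    calc G * A.transpose * A * (G * A.transpose)
        = G * (A.transpose * A) * G * A.transpose := by simp only [Matrix.mul_assoc]
      _ = G * A.transpose := by rw [← hH, hGHG]
  · rw [hp]
    simp only [Matrix.transpose_mul, Matrix.transpose_transpose, hGt, Matrix.mul_assoc]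
  · rw [hp, Matrix.mul_assoc, ← hH, Matrix.transpose_mul, hGt, hHt, hHG, hGH]

theorem risk_sampleLaw_ne_top {dx dy : ℕ} (Astar : Matrix (Fin dy) (Fin dx) ℝ)
    (Px : Measure (EuclideanSpace ℝ (Fin dx))) [IsProbabilityMeasure Px]
    (Sε : Matrix (Fin dy) (Fin dy) ℝ) :
    risk (sampleLaw Astar Px Sε) Astar ≠ ∞ := by
  have hc : Continuous (Matrix.toEuclideanLin Astar) := LinearMap.continuous_of_finiteDimensional _
  have hm : Measurable (Matrix.toEuclideanLin Astar) := hc.measurable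
  have hi : Integrable (fun e => ‖e‖ ^ 2) (multivariateGaussian 0 Sε) :=
    (IsGaussian.memLp_two_id (μ := multivariateGaussian 0 Sε)).norm.integrable_sq
  rw [risk, sampleLaw, lintegral_map (by fun_prop) (by fun_prop),
    lintegral_prod _ (by fun_prop)]
  simp only [sub_add_cancel_left, norm_neg, lintegral_const, measure_univ, mul_one]
  exact hi.lintegral_lt_top.ne

end LoRA

end

/-! Write `R` for the square root of the empirical covariance, `E` for the noise matrix, Δ⋆ = A⋆ -
A₀. Since X X† R = R, the matrix that LoRA truncates is B + E X† R with B = Δ⋆ R of rank at most r: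
a low-rank signal plus noise. Weyl's inequality makes the truncation `T` satisfy ‖T - B‖ ≤ 2‖E X† R‖
in operator norm (`singularValue_le_opNorm_sub`). As T - B has rank at most 2r, its squared
Frobenius norm is at most 8r‖E X† R‖² ≤ 8r‖E‖²/n (`frobSq_truncation_sub_le`, `empCov_sqrt_facts`).
No gap between singular values is needed, so any choice of truncation will do.

Because R R† = X X†, the error is Â - A⋆ = (T - B) R† - Δ⋆ P_X^⊥. Multiplied by the square root of
Σ_xx, the second summand gives the bias term; in the first, the squared norm of R† Σ_xx^{1/2} is
exactly the largest eigenvalue of Σ_xx Σ̂_xx† (`lambdaMax_mul_pinv`). This is the deterministic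
bound `frobSq_loRA_sub_le`, and `risk_eq_add` identifies the excess risk with the squared Frobenius
norm it controls.

Two probabilistic facts remain. Features and noise are independent, so the expectation of ‖E‖² times
that eigenvalue factors (`lintegral_features_mul_noise`). And E‖E‖² is at most a constant times (n +
d_y) λ_max(Σ_εε) (`lintegral_opNorm_sq_multivariateGaussian_le`), which follows from an exponential
moment bound for Gaussian matrices. -/

noncomputable section

namespace LoRA

/-! ### Operator norm of a standard Gaussian matrix -/

section GaussianNoise

open scoped Matrix.Norms.L2Operator RealInnerProductSpace

theorem mgf_stdGaussian_inner {d : ℕ} (w : EuclideanSpace ℝ (Fin d)) :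
    Integrable (fun g => Real.exp ⟪w, g⟫) (stdGaussian (EuclideanSpace ℝ (Fin d))) ∧
    ∫ g, Real.exp ⟪w, g⟫ ∂stdGaussian (EuclideanSpace ℝ (Fin d)) = Real.exp (‖w‖ ^ 2 / 2) := by
  have hmap : (stdGaussian (EuclideanSpace ℝ (Fin d))).map (fun g => ⟪w, g⟫) =
      gaussianReal 0 (‖w‖₊ ^ 2) := by
    have := IsGaussian.map_eq_gaussianReal (μ := stdGaussian (EuclideanSpace ℝ (Fin d)))
      (innerSL ℝ w)
    rw [integral_strongDual_stdGaussian, variance_dual_stdGaussian, innerSL_apply_norm] at this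
    rw [show (fun g => ⟪w, g⟫) = (innerSL ℝ w : EuclideanSpace ℝ (Fin d) → ℝ) from rfl, this]
    congr 1
    ext; simp
  constructor
  · have h := integrable_exp_mul_gaussianReal (μ := 0) (v := ‖w‖₊ ^ 2) 1
    rw [← hmap, integrable_map_measure (by fun_prop) (by fun_prop)] at h
    simpa [Function.comp_def] using h
  · have h := mgf_gaussianReal hmap 1
    simpa [mgf] using h

theorem inner_colMatrix {d n : ℕ} (g : Fin n → EuclideanSpace ℝ (Fin d))
    (u : EuclideanSpace ℝ (Fin n)) (w : EuclideanSpace ℝ (Fin d)) :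
    ⟪w, Matrix.toEuclideanLin (colMatrix g) u⟫ = ∑ i, ⟪u i • w, g i⟫ := by
  simp only [PiLp.inner_apply, colMatrix, Matrix.ofLp_toLpLin, Matrix.toLin'_apply,
    Matrix.mulVec, dotProduct, RCLike.inner_apply, conj_trivial, Matrix.of_apply,
    PiLp.smul_apply, smul_eq_mul, Finset.sum_mul]
  rw [Finset.sum_comm]
  refine Finset.sum_congr rfl fun i _ => Finset.sum_congr rfl fun j _ => by ring

theorem lintegral_exp_inner_colMatrix {d n : ℕ}
    (u : EuclideanSpace ℝ (Fin n)) (w : EuclideanSpace ℝ (Fin d)) :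
    ∫⁻ g, ENNReal.ofReal (Real.exp ⟪w, Matrix.toEuclideanLin (colMatrix g) u⟫)
      ∂Measure.pi (fun _ : Fin n => stdGaussian (EuclideanSpace ℝ (Fin d))) =
    ENNReal.ofReal (Real.exp (‖u‖ ^ 2 * ‖w‖ ^ 2 / 2)) := by
  simp only [inner_colMatrix, Real.exp_sum]
  rw [← ofReal_integral_eq_lintegral_ofReal]
  · rw [integral_fintype_prod_eq_prod
      (f := fun (i : Fin n) (x : EuclideanSpace ℝ (Fin d)) => Real.exp ⟪u i • w, x⟫)]
    simp only [(mgf_stdGaussian_inner _).2, ← Real.exp_sum, norm_smul, mul_pow,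
      ← Finset.sum_div, ← Finset.sum_mul, EuclideanSpace.norm_sq_eq u]
  · exact Integrable.fintype_prod fun i => (mgf_stdGaussian_inner _).1
  · exact Filter.Eventually.of_forall fun g => Finset.prod_nonneg fun _ _ => (Real.exp_pos _).le

/-- A substitute for an ε-net: the bilinear form is comparable to ‖L‖ not just at a nearly optimal
pair but on a product of balls of fixed radius, so averaging over the unit balls sees the norm. -/
theorem exists_balls_opNorm_le_inner {E F : Type*} [NormedAddCommGroup E] [InnerProductSpace ℝ E]
    [NormedAddCommGroup F] [InnerProductSpace ℝ F] (L : E →L[ℝ] F) :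
    ∃ (x : E) (y : F), Metric.ball x (1 / 4) ⊆ Metric.ball 0 1 ∧
      Metric.ball y (1 / 4) ⊆ Metric.ball 0 1 ∧
      ∀ u ∈ Metric.ball x (1 / 4), ∀ w ∈ Metric.ball y (1 / 4), ‖L‖ / 16 ≤ ⟪w, L u⟫ := by
  rcases eq_or_ne L 0 with rfl | hL
  · exact ⟨0, 0, Metric.ball_subset_ball (by norm_num), Metric.ball_subset_ball (by norm_num),
      by simp⟩
  have hLpos : 0 < ‖L‖ := norm_pos_iff.mpr hL
  obtain ⟨x, hx1, hx⟩ := L.exists_lt_apply_of_lt_opNorm (r := 15 / 16 * ‖L‖) (by linarith)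
  have hLx : 0 < ‖L x‖ := lt_trans (by positivity) hx
  set y : F := (‖L x‖)⁻¹ • L x with hy
  have hyn : ‖y‖ = 1 := by
    rw [hy, norm_smul, norm_inv, norm_norm, inv_mul_cancel₀ hLx.ne']
  have hyx : ⟪y, L x⟫ = ‖L x‖ := by
    rw [hy, real_inner_smul_left, real_inner_self_eq_norm_sq]
    field_simp
  -- The factor 3/4 leaves room for radius 1/4 inside the unit ball. In units of ‖L‖ the main term
  -- is at least 9/16 · 15/16, the two cross terms cost 3/16 each and the last term 1/16; what
  -- remains is 23/256 > 1/16.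
  refine ⟨(3 / 4 : ℝ) • x, (3 / 4 : ℝ) • y,
    Metric.ball_subset_ball' ?_, Metric.ball_subset_ball' ?_, fun u hu w hw => ?_⟩
  · rw [dist_zero_right, norm_smul, Real.norm_of_nonneg (by norm_num)]; linarith
  · rw [dist_zero_right, norm_smul, Real.norm_of_nonneg (by norm_num), hyn]; norm_num
  rw [mem_ball_iff_norm] at hu hw
  set a := u - (3 / 4 : ℝ) • x with ha
  set b := w - (3 / 4 : ℝ) • y with hb
  have hu' : u = (3 / 4 : ℝ) • x + a := by rw [ha]; abel
  have hw' : w = (3 / 4 : ℝ) • y + b := by rw [hb]; abel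
  have key : ∀ (p : F) (q : E) (c e : ℝ), ‖p‖ ≤ c → ‖q‖ ≤ e → 0 ≤ c →
      -(c * e * ‖L‖) ≤ ⟪p, L q⟫ := by
    intro p q c e hp hq hc
    have h1 := abs_real_inner_le_norm p (L q)
    have h2 : ‖p‖ * ‖L q‖ ≤ c * (‖L‖ * e) := by
      gcongr
      exact (L.le_opNorm q).trans (by gcongr)
    have := neg_abs_le ⟪p, L q⟫
    nlinarith
  clear_value y
  have hexp : ⟪w, L u⟫ = 3 / 4 * (3 / 4 * ‖L x‖) + 3 / 4 * ⟪y, L a⟫ +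
      (3 / 4 * ⟪b, L x⟫ + ⟪b, L a⟫) := by
    rw [hu', hw']
    simp only [map_add, inner_add_left, inner_add_right, map_smul, real_inner_smul_left,
      real_inner_smul_right, hyx]
    ring
  rw [hexp]
  have h1 := key y a 1 (1 / 4) hyn.le hu.le (by norm_num)
  have h2 := key b x (1 / 4) 1 hw.le hx1.le (by norm_num)
  have h3 := key b a (1 / 4) (1 / 4) hw.le hu.le (by norm_num)
  nlinarith

theorem continuous_colMatrix {d n : ℕ} :
    Continuous (colMatrix : (Fin n → EuclideanSpace ℝ (Fin d)) → Matrix (Fin d) (Fin n) ℝ) := by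
  unfold colMatrix
  fun_prop

/-- Integrate exp(t⟨w, G u⟩) over `u`, `w` in the unit balls. For each fixed `G` the good pair of
balls fills a fraction 4^{-(n+d)} of the volume and bounds the integral from below; after Tonelli,
the Gaussian moment generating function bounds it from above. The volume `V` cancels. -/
theorem lintegral_exp_opNorm_le (d n : ℕ) (t : ℝ) (ht : 0 ≤ t) :
    ∫⁻ g, ENNReal.ofReal (Real.exp (t * (‖colMatrix g‖ / 16)))
      ∂Measure.pi (fun _ : Fin n => stdGaussian (EuclideanSpace ℝ (Fin d))) ≤
    ENNReal.ofReal (4 ^ (n + d) * Real.exp (t ^ 2 / 2)) := by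
  set ν := Measure.pi (fun _ : Fin n => stdGaussian (EuclideanSpace ℝ (Fin d)))
  set B : Set (EuclideanSpace ℝ (Fin n) × EuclideanSpace ℝ (Fin d)) :=
    Metric.ball 0 1 ×ˢ Metric.ball 0 1 with hB
  set V := (volume : Measure (EuclideanSpace ℝ (Fin n) × EuclideanSpace ℝ (Fin d))) B with hV
  set f : (Fin n → EuclideanSpace ℝ (Fin d)) →
      EuclideanSpace ℝ (Fin n) × EuclideanSpace ℝ (Fin d) → ℝ≥0∞ := fun g z =>
    ENNReal.ofReal (Real.exp ⟪t • z.2, Matrix.toEuclideanLin (colMatrix g) z.1⟫) with hf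
  have hVprod : V = volume (Metric.ball (0 : EuclideanSpace ℝ (Fin n)) 1) *
      volume (Metric.ball (0 : EuclideanSpace ℝ (Fin d)) 1) := by
    rw [hV, hB, Measure.volume_eq_prod, Measure.prod_prod]
  have hV0 : V ≠ 0 := by
    rw [hVprod]
    exact mul_ne_zero (Metric.measure_ball_pos _ _ one_pos).ne'
      (Metric.measure_ball_pos _ _ one_pos).ne'
  have hVtop : V ≠ ∞ := by
    rw [hVprod]
    exact ENNReal.mul_ne_top measure_ball_lt_top.ne measure_ball_lt_top.ne
  have hfm : Measurable (Function.uncurry f) := by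
    have hu : Function.uncurry f = fun p => ENNReal.ofReal (Real.exp
        (∑ i, ⟪p.2.1 i • (t • p.2.2), p.1 i⟫)) := by
      ext p; simp only [Function.uncurry, hf, inner_colMatrix]
    rw [hu]
    fun_prop
  have hlow : ∀ g, ENNReal.ofReal (Real.exp (t * (‖colMatrix g‖ / 16))) *
      (ENNReal.ofReal ((1 / 4) ^ (n + d)) * V) ≤ ∫⁻ z in B, f g z := by
    intro g
    obtain ⟨x, y, hx, hy, hxy⟩ := exists_balls_opNorm_le_inner
      (LinearMap.toContinuousLinearMap (Matrix.toEuclideanLin (colMatrix g)))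
    have hsub : Metric.ball x (1 / 4) ×ˢ Metric.ball y (1 / 4) ⊆ B := Set.prod_mono hx hy
    refine le_trans ?_ (lintegral_mono_set hsub)
    have hvol : (volume : Measure (EuclideanSpace ℝ (Fin n) × EuclideanSpace ℝ (Fin d)))
        (Metric.ball x (1 / 4) ×ˢ Metric.ball y (1 / 4)) =
        ENNReal.ofReal ((1 / 4) ^ (n + d)) * V := by
      rw [Measure.volume_eq_prod, Measure.prod_prod,
        Measure.addHaar_ball_of_pos _ x (by norm_num), Measure.addHaar_ball_of_pos _ y (by norm_num),
        hVprod, finrank_euclideanSpace_fin, finrank_euclideanSpace_fin, pow_add,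
        ENNReal.ofReal_mul (by positivity)]
      ring
    rw [← hvol, ← setLIntegral_const]
    refine setLIntegral_mono' (measurableSet_ball.prod measurableSet_ball) fun z hz => ?_
    refine ENNReal.ofReal_le_ofReal (Real.exp_le_exp.mpr ?_)
    rw [real_inner_smul_left]
    exact mul_le_mul_of_nonneg_left (hxy z.1 hz.1 z.2 hz.2) ht
  have hup : ∀ z ∈ B, ∫⁻ g, f g z ∂ν ≤ ENNReal.ofReal (Real.exp (t ^ 2 / 2)) := by
    intro z hz
    rw [hf, lintegral_exp_inner_colMatrix]
    refine ENNReal.ofReal_le_ofReal (Real.exp_le_exp.mpr ?_)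
    have h1 : ‖z.1‖ < 1 := mem_ball_zero_iff.mp hz.1
    have h2 : ‖z.2‖ < 1 := mem_ball_zero_iff.mp hz.2
    rw [norm_smul, mul_pow, Real.norm_eq_abs, sq_abs]
    have h3 : ‖z.1‖ ^ 2 ≤ 1 := pow_le_one₀ (norm_nonneg _) h1.le
    have h4 : ‖z.2‖ ^ 2 ≤ 1 := pow_le_one₀ (norm_nonneg _) h2.le
    have h5 : ‖z.1‖ ^ 2 * (t ^ 2 * ‖z.2‖ ^ 2) ≤ 1 * (t ^ 2 * 1) := by gcongr
    linarith
  have hmain : (∫⁻ g, ENNReal.ofReal (Real.exp (t * (‖colMatrix g‖ / 16))) ∂ν) *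
      (ENNReal.ofReal ((1 / 4) ^ (n + d)) * V) ≤ ENNReal.ofReal (Real.exp (t ^ 2 / 2)) * V := by
    have hc : ENNReal.ofReal ((1 / 4) ^ (n + d)) * V ≠ ∞ :=
      ENNReal.mul_ne_top ENNReal.ofReal_ne_top hVtop
    calc _ = ∫⁻ g, ENNReal.ofReal (Real.exp (t * (‖colMatrix g‖ / 16))) *
          (ENNReal.ofReal ((1 / 4) ^ (n + d)) * V) ∂ν := (lintegral_mul_const' _ _ hc).symm
      _ ≤ ∫⁻ g, (∫⁻ z in B, f g z) ∂ν := lintegral_mono hlow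
      _ = ∫⁻ z in B, (∫⁻ g, f g z ∂ν) := lintegral_lintegral_swap hfm.aemeasurable
      _ ≤ ∫⁻ _ in B, ENNReal.ofReal (Real.exp (t ^ 2 / 2)) :=
          setLIntegral_mono' (measurableSet_ball.prod measurableSet_ball) hup
      _ = _ := setLIntegral_const _ _
  rw [← mul_assoc, ENNReal.mul_le_mul_iff_left hV0 hVtop] at hmain
  calc _ = ((∫⁻ g, ENNReal.ofReal (Real.exp (t * (‖colMatrix g‖ / 16))) ∂ν) *
        ENNReal.ofReal ((1 / 4) ^ (n + d))) * ENNReal.ofReal (4 ^ (n + d)) := by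
        rw [mul_assoc, ← ENNReal.ofReal_mul (by positivity), ← mul_pow]
        norm_num
    _ ≤ ENNReal.ofReal (Real.exp (t ^ 2 / 2)) * ENNReal.ofReal (4 ^ (n + d)) := by gcongr
    _ = _ := by rw [mul_comm, ENNReal.ofReal_mul (by positivity)]

/-- The second moment of the operator norm of a standard Gaussian matrix. -/
theorem lintegral_opNorm_sq_stdGaussian_le (d n : ℕ) (hn : 0 < n) :
    ∫⁻ g, ENNReal.ofReal (‖colMatrix g‖ ^ 2)
      ∂Measure.pi (fun _ : Fin n => stdGaussian (EuclideanSpace ℝ (Fin d))) ≤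
    ENNReal.ofReal (3072 * (n + d)) := by
  set ν := Measure.pi (fun _ : Fin n => stdGaussian (EuclideanSpace ℝ (Fin d)))
  set m : ℝ := n + d with hm
  have hm1 : 1 ≤ m := by
    have : (1 : ℝ) ≤ n := by exact_mod_cast hn
    have : (0 : ℝ) ≤ d := by positivity
    linarith
  -- With t = √m the factor exp(t²/2) is exponential in m, like the entropy factor 4^m; their
  -- product is at most exp(2m).
  have hexp := lintegral_exp_opNorm_le d n (√m) (Real.sqrt_nonneg m)
  rw [Real.sq_sqrt (by linarith)] at hexp
  have h4 : (4 : ℝ) ^ (n + d) * Real.exp (m / 2) ≤ Real.exp (2 * m) := by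
    have h : (4 : ℝ) ≤ Real.exp (3 / 2) := by
      have h1 := Real.exp_one_gt_d9
      have h2 : Real.exp (3 / 2) ^ 2 = Real.exp 1 ^ 3 := by
        rw [← Real.exp_nat_mul, ← Real.exp_nat_mul]; norm_num
      have h3 : (2.7 : ℝ) ^ 3 ≤ Real.exp 1 ^ 3 := by gcongr; linarith
      have h5 := Real.exp_pos (3 / 2)
      nlinarith
    calc (4 : ℝ) ^ (n + d) * Real.exp (m / 2)
        ≤ Real.exp (3 / 2) ^ (n + d) * Real.exp (m / 2) := by gcongr
      _ = Real.exp (2 * m) := by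
        rw [← Real.exp_nat_mul, ← Real.exp_add]
        congr 1
        push_cast
        rw [← hm]; ring
  have hpt : ∀ l : ℝ, 0 ≤ l → l ^ 2 ≤ 256 / m * (8 * m ^ 2) +
      1024 / m * Real.exp (-(2 * m)) * Real.exp (√m * (l / 16)) := by
    intro l hl0
    set s := √m * (l / 16) with hs
    have hl : l ^ 2 = 256 / m * s ^ 2 := by
      rw [hs, mul_pow, Real.sq_sqrt (by linarith)]
      field_simp
      norm_num
    have he : Real.exp (-(2 * m)) * Real.exp s = Real.exp (s - 2 * m) := by
      rw [← Real.exp_add]; congr 1; ring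
    -- Beyond the threshold 2m, use s² ≤ 2(s - 2m)² + 8m², whose defect is (s - 4m)², and x²/2 ≤ exp
    -- x at x = s - 2m.
    have hss : s ^ 2 ≤ 8 * m ^ 2 + 4 * Real.exp (s - 2 * m) := by
      have hs0 : 0 ≤ s := by positivity
      rcases le_total s (2 * m) with h | h
      · have := Real.exp_pos (s - 2 * m)
        nlinarith
      · have := Real.quadratic_le_exp_of_nonneg (sub_nonneg.mpr h)
        nlinarith [sq_nonneg (s - 4 * m)]
    rw [hl, mul_assoc, he]
    calc 256 / m * s ^ 2 ≤ 256 / m * (8 * m ^ 2 + 4 * Real.exp (s - 2 * m)) := by gcongr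
      _ = _ := by ring
  calc ∫⁻ g, ENNReal.ofReal (‖colMatrix g‖ ^ 2) ∂ν
      ≤ ∫⁻ g, (ENNReal.ofReal (256 / m * (8 * m ^ 2)) +
          ENNReal.ofReal (1024 / m * Real.exp (-(2 * m))) *
            ENNReal.ofReal (Real.exp (√m * (‖colMatrix g‖ / 16)))) ∂ν := by
        refine lintegral_mono fun g => ?_
        rw [← ENNReal.ofReal_mul (by positivity), ← ENNReal.ofReal_add (by positivity)
          (by positivity)]
        exact ENNReal.ofReal_le_ofReal (hpt _ (norm_nonneg _))
    _ = ENNReal.ofReal (256 / m * (8 * m ^ 2)) +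
          ENNReal.ofReal (1024 / m * Real.exp (-(2 * m))) *
            ∫⁻ g, ENNReal.ofReal (Real.exp (√m * (‖colMatrix g‖ / 16))) ∂ν := by
        rw [lintegral_add_left measurable_const, lintegral_const,
          lintegral_const_mul' _ _ ENNReal.ofReal_ne_top, measure_univ, mul_one]
    _ ≤ ENNReal.ofReal (256 / m * (8 * m ^ 2)) +
          ENNReal.ofReal (1024 / m * Real.exp (-(2 * m))) * ENNReal.ofReal (Real.exp (2 * m)) := by
        gcongr
        exact hexp.trans (ENNReal.ofReal_le_ofReal h4)
    _ ≤ ENNReal.ofReal (3072 * m) := by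
        rw [← ENNReal.ofReal_mul (by positivity), ← ENNReal.ofReal_add (by positivity)
          (by positivity), mul_assoc, ← Real.exp_add, neg_add_cancel, Real.exp_zero, mul_one]
        refine ENNReal.ofReal_le_ofReal ?_
        have : 1024 / m ≤ 1024 * m := by
          rw [div_le_iff₀ (by linarith)]; nlinarith
        have h2 : 256 / m * (8 * m ^ 2) = 2048 * m := by field_simp; norm_num
        linarith

end GaussianNoise

/-! ### Uniqueness and symmetry of the Moore–Penrose inverse -/

section MoorePenrose

variable {p q d : ℕ}

/-- `A * B` and `A * C` are both the orthogonal projection onto the range of `A`, and `B * A`, `C *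
A` the one onto its row space. Later identities for `pinv`, and its measurability, come from here
and not from the functional calculus. -/
theorem IsMoorePenrose.unique {A : Matrix (Fin p) (Fin q) ℝ} {B C : Matrix (Fin q) (Fin p) ℝ}
    (hB : IsMoorePenrose A B) (hC : IsMoorePenrose A C) : B = C := by
  obtain ⟨b1, b2, b3, b4⟩ := hB
  obtain ⟨c1, c2, c3, c4⟩ := hC
  have hAB : A * B = A * C := by
    calc A * B = A * C * A * B := by rw [c1]
      _ = (A * C).transpose * (A * B).transpose := by rw [b3, c3, Matrix.mul_assoc (A * C)]
      _ = (A * B * A * C).transpose := by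
        rw [← Matrix.transpose_mul, Matrix.mul_assoc (A * B)]
      _ = A * C := by rw [b1, c3]
  have hBA : B * A = C * A := by
    calc B * A = B * (A * C * A) := by rw [c1]
      _ = (B * A).transpose * (C * A).transpose := by rw [b4, c4]; simp only [Matrix.mul_assoc]
      _ = (C * (A * B * A)).transpose := by
        rw [← Matrix.transpose_mul]; simp only [Matrix.mul_assoc]
      _ = C * A := by rw [b1, c4]
  calc B = B * A * B := b2.symm
    _ = C * A * B := by rw [hBA]
    _ = C * (A * C) := by rw [Matrix.mul_assoc, hAB]
    _ = C := by rw [← Matrix.mul_assoc, c2]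

theorem pinv_transpose_of_symm {S : Matrix (Fin d) (Fin d) ℝ} (hS : S.transpose = S) :
    (pinv S).transpose = pinv S := by
  obtain ⟨h1, h2, h3, h4⟩ := isMoorePenrose_pinv S
  refine IsMoorePenrose.unique (A := S) ⟨?_, ?_, ?_, ?_⟩ (isMoorePenrose_pinv S)
  · conv_rhs => rw [← hS, ← h1]
    simp only [Matrix.transpose_mul, hS, Matrix.mul_assoc]
  · conv_rhs => rw [← h2]
    simp only [Matrix.transpose_mul, hS, Matrix.mul_assoc]
  · have e : S * (pinv S).transpose = pinv S * S := by rw [← h4, Matrix.transpose_mul, hS]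
    rw [e, h4]
  · have e : (pinv S).transpose * S = S * pinv S := by rw [← h3, Matrix.transpose_mul, hS]
    rw [e, h3]

theorem mul_pinv_comm_of_symm {S : Matrix (Fin d) (Fin d) ℝ} (hS : S.transpose = S) :
    S * pinv S = pinv S * S := by
  have h3 := (isMoorePenrose_pinv S).2.2.1
  rw [Matrix.transpose_mul, hS, pinv_transpose_of_symm hS] at h3
  exact h3.symm

theorem pinv_mul_self_of_symm {S : Matrix (Fin d) (Fin d) ℝ} (hS : S.transpose = S) :
    pinv (S * S) = pinv S * pinv S := by
  obtain ⟨h1, h2, h3, h4⟩ := isMoorePenrose_pinv S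
  have hc := mul_pinv_comm_of_symm hS
  have e1 : S * S * (pinv S * pinv S) = S * pinv S := by
    calc S * S * (pinv S * pinv S) = S * (S * pinv S) * pinv S := by simp only [Matrix.mul_assoc]
      _ = S * (pinv S * S) * pinv S := by rw [hc]
      _ = S * pinv S := by rw [← Matrix.mul_assoc, h1]
  have e2 : pinv S * pinv S * (S * S) = pinv S * S := by
    calc pinv S * pinv S * (S * S) = pinv S * (pinv S * S) * S := by simp only [Matrix.mul_assoc]
      _ = pinv S * (S * pinv S) * S := by rw [hc]
      _ = pinv S * S := by rw [← Matrix.mul_assoc, h2]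
  refine IsMoorePenrose.unique (isMoorePenrose_pinv _) ⟨?_, ?_, ?_, ?_⟩
  · rw [e1, ← Matrix.mul_assoc, h1]
  · rw [e2, ← Matrix.mul_assoc, h2]
  · rw [e1, h3]
  · rw [e2, h4]

end MoorePenrose

/-! ### Positive semidefinite square roots -/

section SquareRoot

variable {d : ℕ} {S : Matrix (Fin d) (Fin d) ℝ}

open scoped MatrixOrder in
theorem posSemidef_psdSqrt (S : Matrix (Fin d) (Fin d) ℝ) : (psdSqrt S).PosSemidef :=
  Matrix.nonneg_iff_posSemidef.mp (CFC.sqrt_nonneg S)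

open scoped MatrixOrder in
theorem psdSqrt_mul_self (hS : S.PosSemidef) : psdSqrt S * psdSqrt S = S :=
  CFC.sqrt_mul_sqrt_self S hS.nonneg

theorem psdSqrt_transpose (S : Matrix (Fin d) (Fin d) ℝ) : (psdSqrt S).transpose = psdSqrt S := by
  have := (posSemidef_psdSqrt S).isHermitian.eq
  rwa [Matrix.conjTranspose_eq_transpose_of_trivial] at this

theorem pinv_eq_pinv_psdSqrt_mul (hS : S.PosSemidef) :
    pinv S = pinv (psdSqrt S) * pinv (psdSqrt S) := by
  rw [← pinv_mul_self_of_symm (psdSqrt_transpose S), psdSqrt_mul_self hS]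

end SquareRoot

/-! ### Largest eigenvalues as operator norms -/

section OperatorNorm

open scoped Matrix.Norms.L2Operator

variable {p q k d : ℕ}

theorem opNorm_transpose (A : Matrix (Fin p) (Fin q) ℝ) : ‖A.transpose‖ = ‖A‖ := by
  rw [← Matrix.conjTranspose_eq_transpose_of_trivial, Matrix.l2_opNorm_conjTranspose]

theorem opNorm_transpose_mul_self (A : Matrix (Fin p) (Fin q) ℝ) :
    ‖A.transpose * A‖ = ‖A‖ ^ 2 := by
  rw [← Matrix.conjTranspose_eq_transpose_of_trivial, Matrix.l2_opNorm_conjTranspose_mul_self, sq]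

theorem opNorm_le_one_of_proj {P : Matrix (Fin d) (Fin d) ℝ} (hP : P.transpose = P)
    (hPP : P * P = P) : ‖P‖ ≤ 1 := by
  have h := opNorm_transpose_mul_self P
  rw [hP, hPP] at h
  have := norm_nonneg P
  nlinarith

theorem posSemidef_transpose_mul_self (A : Matrix (Fin p) (Fin q) ℝ) :
    (A.transpose * A).PosSemidef := by
  rw [← Matrix.conjTranspose_eq_transpose_of_trivial]
  exact Matrix.posSemidef_conjTranspose_mul_self A

theorem bddAbove_spectrum (M : Matrix (Fin d) (Fin d) ℝ) : BddAbove (spectrum ℝ M) :=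
  Matrix.finite_real_spectrum.bddAbove

theorem lambdaMax_eq_opNorm {M : Matrix (Fin d) (Fin d) ℝ} (hM : M.PosSemidef) :
    lambdaMax M = ‖M‖ := by
  have hnn : ∀ x ∈ spectrum ℝ M, 0 ≤ x := by
    intro x hx
    rw [hM.1.spectrum_real_eq_range_eigenvalues] at hx
    obtain ⟨i, rfl⟩ := hx
    exact hM.eigenvalues_nonneg i
  apply le_antisymm
  · refine Real.sSup_le (fun x hx => ?_) (norm_nonneg _)
    have h := spectrum.norm_le_norm_mul_of_mem hx
    have h1 : ‖(1 : Matrix (Fin d) (Fin d) ℝ)‖ ≤ 1 :=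
      opNorm_le_one_of_proj Matrix.transpose_one (Matrix.one_mul _)
    calc x ≤ ‖x‖ := Real.le_norm_self x
      _ ≤ ‖M‖ * ‖(1 : Matrix (Fin d) (Fin d) ℝ)‖ := h
      _ ≤ ‖M‖ * 1 := by gcongr
      _ = ‖M‖ := mul_one _
  · have hU : ∀ U : Matrix.unitaryGroup (Fin d) ℝ, ‖(U : Matrix (Fin d) (Fin d) ℝ)‖ ≤ 1 := by
      intro U
      have h := opNorm_transpose_mul_self (U : Matrix (Fin d) (Fin d) ℝ)
      have h2 : (U : Matrix (Fin d) (Fin d) ℝ).transpose * U = 1 := by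
        have := U.2.1
        rwa [Matrix.star_eq_conjTranspose, Matrix.conjTranspose_eq_transpose_of_trivial] at this
      have h1 : ‖(1 : Matrix (Fin d) (Fin d) ℝ)‖ ≤ 1 :=
        opNorm_le_one_of_proj Matrix.transpose_one (Matrix.one_mul _)
      rw [h2] at h
      have := norm_nonneg (U : Matrix (Fin d) (Fin d) ℝ)
      nlinarith
    have hD : ‖(Matrix.diagonal hM.1.eigenvalues : Matrix (Fin d) (Fin d) ℝ)‖ ≤ lambdaMax M := by
      rw [Matrix.l2_opNorm_diagonal]
      refine (pi_norm_le_iff_of_nonneg (Real.sSup_nonneg hnn)).mpr fun i => ?_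
      rw [Real.norm_of_nonneg (hM.eigenvalues_nonneg i)]
      exact le_csSup (bddAbove_spectrum M) (hM.1.eigenvalues_mem_spectrum_real i)
    have hspec := hM.1.spectral_theorem
    rw [Unitary.conjStarAlgAut_apply] at hspec
    calc ‖M‖ = _ := congrArg norm hspec
      _ ≤ ‖(hM.1.eigenvectorUnitary : Matrix (Fin d) (Fin d) ℝ)‖ *
          ‖(Matrix.diagonal hM.1.eigenvalues : Matrix (Fin d) (Fin d) ℝ)‖ *
          ‖((star hM.1.eigenvectorUnitary : Matrix.unitaryGroup (Fin d) ℝ) :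
            Matrix (Fin d) (Fin d) ℝ)‖ := by
          refine (Matrix.l2_opNorm_mul _ _).trans ?_
          exact mul_le_mul_of_nonneg_right (Matrix.l2_opNorm_mul _ _) (norm_nonneg _)
      _ ≤ 1 * lambdaMax M * 1 := by
          have h0 : 0 ≤ lambdaMax M := Real.sSup_nonneg hnn
          gcongr
          · exact hU _
          · exact hU _
      _ = lambdaMax M := by ring

/-- The spectra of `A * B` and `B * A` agree away from 0, and 0 does not affect a supremum of
nonnegative numbers (`sSup ∅ = 0` included). This turns the non-symmetric product in the theorem
into a positive semidefinite one. -/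
theorem lambdaMax_mul_comm_of_posSemidef {A B : Matrix (Fin d) (Fin d) ℝ}
    (hBA : (B * A).PosSemidef) : lambdaMax (A * B) = ‖B * A‖ := by
  have hnn : ∀ x ∈ spectrum ℝ (B * A), 0 ≤ x := by
    intro x hx
    rw [hBA.1.spectrum_real_eq_range_eigenvalues] at hx
    obtain ⟨i, rfl⟩ := hx
    exact hBA.eigenvalues_nonneg i
  have hdiff : spectrum ℝ (A * B) \ {0} = spectrum ℝ (B * A) \ {0} := spectrum.nonzero_mul_comm A B
  have hnn' : ∀ x ∈ spectrum ℝ (A * B), 0 ≤ x := by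
    intro x hx
    by_cases h0 : x = 0
    · exact h0.ge
    · exact hnn x (hdiff.subset ⟨hx, h0⟩).1
  rw [← lambdaMax_eq_opNorm hBA]
  apply le_antisymm
  · refine Real.sSup_le (fun x hx => ?_) (Real.sSup_nonneg hnn)
    by_cases h0 : x = 0
    · rw [h0]; exact Real.sSup_nonneg hnn
    · exact le_csSup (bddAbove_spectrum _) (hdiff.subset ⟨hx, h0⟩).1
  · refine Real.sSup_le (fun x hx => ?_) (Real.sSup_nonneg hnn')
    by_cases h0 : x = 0
    · rw [h0]; exact Real.sSup_nonneg hnn'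
    · exact le_csSup (bddAbove_spectrum _) (hdiff.superset ⟨hx, h0⟩).1

theorem psdSqrt_mul_pinv_mul_psdSqrt (S : Matrix (Fin d) (Fin d) ℝ)
    {T : Matrix (Fin d) (Fin d) ℝ} (hT : T.PosSemidef) :
    psdSqrt S * pinv T * psdSqrt S =
      (pinv (psdSqrt T) * psdSqrt S).transpose * (pinv (psdSqrt T) * psdSqrt S) := by
  rw [Matrix.transpose_mul, psdSqrt_transpose, pinv_transpose_of_symm (psdSqrt_transpose T),
    pinv_eq_pinv_psdSqrt_mul hT]
  simp only [Matrix.mul_assoc]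

theorem lambdaMax_mul_pinv_eq_opNorm {S T : Matrix (Fin d) (Fin d) ℝ} (hS : S.PosSemidef)
    (hT : T.PosSemidef) : lambdaMax (S * pinv T) = ‖psdSqrt S * pinv T * psdSqrt S‖ := by
  have h : lambdaMax (psdSqrt S * (psdSqrt S * pinv T)) = ‖(psdSqrt S * pinv T) * psdSqrt S‖ := by
    apply lambdaMax_mul_comm_of_posSemidef
    rw [psdSqrt_mul_pinv_mul_psdSqrt S hT]
    exact posSemidef_transpose_mul_self _
  rwa [← Matrix.mul_assoc, psdSqrt_mul_self hS] at h

/-- For positive semidefinite `S` and `T`, the largest eigenvalue of `S T†` is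
`‖(T^{1/2})† S^{1/2}‖²`. -/
theorem lambdaMax_mul_pinv {S T : Matrix (Fin d) (Fin d) ℝ} (hS : S.PosSemidef)
    (hT : T.PosSemidef) :
    lambdaMax (S * pinv T) = ‖pinv (psdSqrt T) * psdSqrt S‖ ^ 2 := by
  rw [lambdaMax_mul_pinv_eq_opNorm hS hT, psdSqrt_mul_pinv_mul_psdSqrt S hT,
    opNorm_transpose_mul_self]

theorem lambdaMax_eq_opNorm_psdSqrt_sq {S : Matrix (Fin d) (Fin d) ℝ} (hS : S.PosSemidef) :
    lambdaMax S = ‖psdSqrt S‖ ^ 2 := by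
  rw [lambdaMax_eq_opNorm hS, ← opNorm_transpose_mul_self, psdSqrt_transpose, psdSqrt_mul_self hS]

end OperatorNorm

/-! ### Frobenius norm against operator norm and rank -/

section Frobenius

open scoped Matrix.Norms.L2Operator

variable {p q k d : ℕ}

theorem frobSq_nonneg (A : Matrix (Fin p) (Fin q) ℝ) : 0 ≤ frobSq A :=
  Finset.sum_nonneg fun _ _ => Finset.sum_nonneg fun _ _ => sq_nonneg _

theorem frobSq_sub_le (A B : Matrix (Fin p) (Fin q) ℝ) :
    frobSq (A - B) ≤ 2 * frobSq A + 2 * frobSq B := by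
  simp only [frobSq, Finset.mul_sum, ← Finset.sum_add_distrib, Matrix.sub_apply]
  gcongr with i _ j _
  nlinarith [sq_nonneg (A i j + B i j)]

theorem frobSq_eq_trace (A : Matrix (Fin p) (Fin q) ℝ) :
    frobSq A = (A * A.transpose).trace := by
  simp [frobSq, Matrix.trace, Matrix.mul_apply, sq]

theorem frobSq_transpose (A : Matrix (Fin p) (Fin q) ℝ) : frobSq A.transpose = frobSq A := by
  unfold frobSq
  rw [Finset.sum_comm]
  rfl

theorem frobSq_mul_le (A : Matrix (Fin p) (Fin q) ℝ) (B : Matrix (Fin q) (Fin k) ℝ) :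
    frobSq (A * B) ≤ frobSq A * ‖B‖ ^ 2 := by
  unfold frobSq
  rw [Finset.sum_mul]
  gcongr with i
  have h := Matrix.l2_opNorm_mulVec B.transpose (WithLp.toLp 2 (A i))
  rw [opNorm_transpose] at h
  have h2 := pow_le_pow_left₀ (norm_nonneg _) h 2
  rw [mul_pow, EuclideanSpace.norm_sq_eq, EuclideanSpace.norm_sq_eq] at h2
  simp only [Real.norm_eq_abs, sq_abs, Matrix.mulVec_transpose] at h2
  rw [mul_comm]
  exact h2

/-- The left side is the trace of AᵀA, which has `A.rank` nonzero eigenvalues, each at most ‖A‖². -/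
theorem frobSq_le_rank_mul (A : Matrix (Fin p) (Fin q) ℝ) : frobSq A ≤ A.rank * ‖A‖ ^ 2 := by
  have hH := posSemidef_transpose_mul_self A
  have htr : frobSq A = ∑ i, hH.1.eigenvalues i := by
    rw [← frobSq_transpose, frobSq_eq_trace, Matrix.transpose_transpose,
      hH.1.trace_eq_sum_eigenvalues]
    simp
  have hle : ∀ i, hH.1.eigenvalues i ≤ ‖A‖ ^ 2 := by
    intro i
    rw [← opNorm_transpose_mul_self, ← lambdaMax_eq_opNorm hH]
    exact le_csSup (bddAbove_spectrum _) (hH.1.eigenvalues_mem_spectrum_real i)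
  have hrank : A.rank = (Finset.univ.filter fun i => hH.1.eigenvalues i ≠ 0).card := by
    rw [← Matrix.rank_transpose_mul_self, hH.1.rank_eq_card_non_zero_eigs, Fintype.card_subtype]
  rw [htr, ← Finset.sum_filter_ne_zero, hrank, ← nsmul_eq_mul]
  exact Finset.sum_le_card_nsmul _ _ _ fun i _ => hle i

end Frobenius

/-! ### Singular value truncation and Weyl's inequality -/

section Truncation

open scoped Matrix.Norms.L2Operator RealInnerProductSpace

variable {p q r : ℕ}

theorem rank_sub_le (A B : Matrix (Fin p) (Fin q) ℝ) : (A - B).rank ≤ A.rank + B.rank := by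
  have hsub : LinearMap.range (A - B).mulVecLin ≤
      LinearMap.range A.mulVecLin ⊔ LinearMap.range B.mulVecLin := by
    rintro _ ⟨x, rfl⟩
    rw [Matrix.mulVecLin_apply, Matrix.sub_mulVec]
    exact Submodule.sub_mem_sup ⟨x, rfl⟩ ⟨x, rfl⟩
  exact (Submodule.finrank_mono hsub).trans
    (Submodule.finrank_add_le_finrank_add_finrank _ _)

theorem sum_smul_vecMulVec {m : ℕ} (c : Fin m → ℝ) (u : Fin m → EuclideanSpace ℝ (Fin p))
    (v : Fin m → EuclideanSpace ℝ (Fin q)) :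
    ∑ i, c i • Matrix.vecMulVec (u i).ofLp (v i).ofLp =
      colMatrix u * Matrix.diagonal c * (colMatrix v).transpose := by
  ext a b
  rw [Matrix.mul_apply]
  simp only [Matrix.sum_apply, Matrix.smul_apply, Matrix.vecMulVec_apply, smul_eq_mul,
    Matrix.mul_diagonal, colMatrix, Matrix.of_apply, Matrix.transpose_apply]
  exact Finset.sum_congr rfl fun i _ => by ring

theorem opNorm_colMatrix_le_one {m : ℕ} {u : Fin m → EuclideanSpace ℝ (Fin p)}
    (hu : Orthonormal ℝ u) : ‖colMatrix u‖ ≤ 1 := by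
  have h1 : (colMatrix u).transpose * colMatrix u = 1 := by
    ext i j
    have := orthonormal_iff_ite.mp hu i j
    rw [Matrix.one_apply, ← this]
    simp only [Matrix.mul_apply, colMatrix, Matrix.transpose_apply, Matrix.of_apply,
      PiLp.inner_apply, RCLike.inner_apply, conj_trivial]
    exact Finset.sum_congr rfl fun i _ => by ring
  have h := opNorm_transpose_mul_self (colMatrix u)
  rw [h1] at h
  have h2 : ‖(1 : Matrix (Fin m) (Fin m) ℝ)‖ ≤ 1 :=
    opNorm_le_one_of_proj Matrix.transpose_one (Matrix.one_mul _)
  have := norm_nonneg (colMatrix u)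
  nlinarith

theorem opNorm_sum_smul_vecMulVec_le {m : ℕ} {c : Fin m → ℝ}
    {u : Fin m → EuclideanSpace ℝ (Fin p)} {v : Fin m → EuclideanSpace ℝ (Fin q)}
    (hu : Orthonormal ℝ u) (hv : Orthonormal ℝ v) {s : ℝ} (hs : 0 ≤ s) (hc : ∀ i, |c i| ≤ s) :
    ‖∑ i, c i • Matrix.vecMulVec (u i).ofLp (v i).ofLp‖ ≤ s := by
  rw [sum_smul_vecMulVec]
  have hd : ‖(Matrix.diagonal c : Matrix (Fin m) (Fin m) ℝ)‖ ≤ s := by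
    rw [Matrix.l2_opNorm_diagonal]
    exact (pi_norm_le_iff_of_nonneg hs).mpr hc
  have hv' := opNorm_colMatrix_le_one hv
  rw [← opNorm_transpose] at hv'
  calc _ ≤ ‖colMatrix u * Matrix.diagonal c‖ * ‖(colMatrix v).transpose‖ :=
        Matrix.l2_opNorm_mul _ _
    _ ≤ ‖colMatrix u‖ * ‖(Matrix.diagonal c : Matrix (Fin m) (Fin m) ℝ)‖ *
        ‖(colMatrix v).transpose‖ :=
        mul_le_mul_of_nonneg_right (Matrix.l2_opNorm_mul _ _) (norm_nonneg _)
    _ ≤ 1 * s * 1 := by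
        gcongr
        exact opNorm_colMatrix_le_one hu
    _ = s := by ring

theorem rank_truncation_le {M T : Matrix (Fin p) (Fin q) ℝ} (hT : IsTruncation r M T) :
    T.rank ≤ r := by
  obtain ⟨σ, u, v, -, -, -, -, -, rfl⟩ := hT
  rw [sum_smul_vecMulVec]
  refine (Matrix.rank_mul_le_left _ _).trans ((Matrix.rank_mul_le_right _ _).trans ?_)
  rw [Matrix.rank_diagonal]
  have hlt : ∀ i : {i : Fin (min p q) // (if i.val < r then σ i else 0) ≠ 0}, i.1.1 < r := by
    rintro ⟨i, hi⟩
    by_contra h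
    exact hi (if_neg h)
  simpa using Fintype.card_le_of_injective (fun i => (⟨i.1.1, hlt i⟩ : Fin r)) fun i j h =>
    Subtype.ext (Fin.ext (Fin.mk.inj_iff.mp h))

theorem toEuclideanLin_sum_smul_vecMulVec {m : ℕ} (σ : Fin m → ℝ)
    (u : Fin m → EuclideanSpace ℝ (Fin p)) {v : Fin m → EuclideanSpace ℝ (Fin q)}
    (hv : Orthonormal ℝ v) (j : Fin m) :
    Matrix.toEuclideanLin (∑ i, σ i • Matrix.vecMulVec (u i).ofLp (v i).ofLp) (v j) =
      σ j • u j := by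
  have hvj : ∀ k, (v k).ofLp ⬝ᵥ (v j).ofLp = if k = j then 1 else 0 := by
    intro k
    have := orthonormal_iff_ite.mp hv k j
    rw [← this, PiLp.inner_apply]
    simp [dotProduct, mul_comm]
  ext a
  rw [Matrix.ofLp_toLpLin, Matrix.toLin'_apply, Matrix.sum_mulVec]
  simp [Matrix.smul_mulVec, Matrix.vecMulVec_mulVec, hvj, ite_apply]

theorem norm_sum_smul_sq_of_orthonormal {ι E : Type*} [Fintype ι] [NormedAddCommGroup E]
    [InnerProductSpace ℝ E] {w : ι → E} (hw : Orthonormal ℝ w) (c : ι → ℝ) :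
    ‖∑ j, c j • w j‖ ^ 2 = ∑ j, c j ^ 2 := by
  rw [← real_inner_self_eq_norm_sq, hw.inner_sum c c Finset.univ]
  simp [sq]

theorem norm_toEuclideanLin_le (A : Matrix (Fin p) (Fin q) ℝ) (x : EuclideanSpace ℝ (Fin q)) :
    ‖Matrix.toEuclideanLin A x‖ ≤ ‖A‖ * ‖x‖ := by
  rw [Matrix.l2_opNorm_def]
  exact ContinuousLinearMap.le_opNorm
    (LinearMap.toContinuousLinearMap (Matrix.toEuclideanLin A)) x

theorem exists_ne_zero_toEuclideanLin_sum_eq_zero {B : Matrix (Fin p) (Fin q) ℝ} {k : ℕ}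
    (v : Fin k → EuclideanSpace ℝ (Fin q)) (hk : B.rank < k) :
    ∃ y : Fin k → ℝ, y ≠ 0 ∧ Matrix.toEuclideanLin B (∑ j, y j • v j) = 0 := by
  let g : (Fin k → ℝ) →ₗ[ℝ] EuclideanSpace ℝ (Fin p) :=
    (Matrix.toEuclideanLin B).comp (Fintype.linearCombination ℝ v)
  have hrange : Module.finrank ℝ (LinearMap.range g) ≤ B.rank := by
    rw [Matrix.rank_eq_finrank_range_toLin B (EuclideanSpace.basisFun (Fin p) ℝ).toBasis
      (EuclideanSpace.basisFun (Fin q) ℝ).toBasis]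
    exact Submodule.finrank_mono (LinearMap.range_comp_le_range _ _)
  have hker : LinearMap.ker g ≠ ⊥ := by
    intro h
    have := g.finrank_range_add_finrank_ker
    rw [h, finrank_bot, Module.finrank_fin_fun] at this
    omega
  obtain ⟨y, hy, hy0⟩ := Submodule.exists_mem_ne_zero_of_ne_bot hker
  refine ⟨y, hy0, ?_⟩
  rw [← Fintype.linearCombination_apply]
  exact hy

/-- Weyl's bound: every singular value of `M` of index at least `rank B` is at most `‖M - B‖`. -/
theorem singularValue_le_opNorm_sub {m : ℕ} {σ : Fin m → ℝ}
    {u : Fin m → EuclideanSpace ℝ (Fin p)} {v : Fin m → EuclideanSpace ℝ (Fin q)}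
    (hu : Orthonormal ℝ u) (hv : Orthonormal ℝ v) (hσ : Antitone σ) (hσ0 : ∀ i, 0 ≤ σ i)
    {M B : Matrix (Fin p) (Fin q) ℝ}
    (hM : M = ∑ i, σ i • Matrix.vecMulVec (u i).ofLp (v i).ofLp) (i : Fin m)
    (hi : B.rank ≤ i) : σ i ≤ ‖M - B‖ := by
  obtain ⟨e, heinj, he⟩ : ∃ e : Fin (i.val + 1) → Fin m, Function.Injective e ∧ ∀ j, e j ≤ i :=
    ⟨Fin.castLE i.2, Fin.castLE_injective _, fun j => Nat.lt_succ_iff.mp j.2⟩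
  have hMv := fun j => toEuclideanLin_sum_smul_vecMulVec σ u hv j
  rw [← hM] at hMv
  -- The right singular vectors 0, …, i number i + 1 > rank B, so some nonzero combination x lies in
  -- the kernel of `B`. There (M - B)x = Mx, and ‖Mx‖ ≥ σᵢ‖x‖ because all singular values involved
  -- are at least σᵢ.
  obtain ⟨y, hy0, hy⟩ := exists_ne_zero_toEuclideanLin_sum_eq_zero (v ∘ e) (Nat.lt_succ_of_le hi)
  obtain ⟨x, hx⟩ : ∃ x, x = ∑ j, y j • (v ∘ e) j := ⟨_, rfl⟩
  rw [← hx] at hy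
  have hxn : ‖x‖ ^ 2 = ∑ j, y j ^ 2 := by
    rw [hx]
    exact norm_sum_smul_sq_of_orthonormal (hv.comp e heinj) y
  have hMx : Matrix.toEuclideanLin (M - B) x = ∑ j, (y j * σ (e j)) • (u ∘ e) j := by
    rw [map_sub, LinearMap.sub_apply, hy, sub_zero, hx, map_sum]
    simp [hMv, smul_smul]
  have hMxn : ‖Matrix.toEuclideanLin (M - B) x‖ ^ 2 = ∑ j, (y j * σ (e j)) ^ 2 := by
    rw [hMx]; exact norm_sum_smul_sq_of_orthonormal (hu.comp e heinj) _
  have hop : ‖Matrix.toEuclideanLin (M - B) x‖ ≤ ‖M - B‖ * ‖x‖ :=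
    norm_toEuclideanLin_le _ _
  have hxpos : 0 < ‖x‖ ^ 2 := by
    rw [hxn]
    obtain ⟨j, hj⟩ := Function.ne_iff.mp hy0
    exact Finset.sum_pos' (fun _ _ => sq_nonneg _) ⟨j, Finset.mem_univ _, sq_pos_of_ne_zero hj⟩
  have hlow : σ i ^ 2 * ‖x‖ ^ 2 ≤ ‖Matrix.toEuclideanLin (M - B) x‖ ^ 2 := by
    rw [hMxn, hxn, Finset.mul_sum]
    refine Finset.sum_le_sum fun j _ => ?_
    rw [mul_pow, mul_comm]
    exact mul_le_mul_of_nonneg_left (pow_le_pow_left₀ (hσ0 i) (hσ (he j)) 2) (sq_nonneg _)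
  have hup := pow_le_pow_left₀ (norm_nonneg _) hop 2
  rw [mul_pow] at hup
  exact le_of_sq_le_sq (le_of_mul_le_mul_right (hlow.trans hup) hxpos) (norm_nonneg _)

/-- A rank-`r` truncation of a perturbation of a matrix `B` of rank at most `r` is close to `B`. -/
theorem frobSq_truncation_sub_le {M T B : Matrix (Fin p) (Fin q) ℝ} (hT : IsTruncation r M T)
    (hB : B.rank ≤ r) : frobSq (T - B) ≤ 8 * r * ‖M - B‖ ^ 2 := by
  have hrT := rank_truncation_le hT
  obtain ⟨σ, u, v, hu, hv, hσ, hσ0, hM, hTe⟩ := hT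
  -- The singular values surviving in M - T have index at least r ≥ rank B, where Weyl's bound
  -- applies.
  have hMT : ‖M - T‖ ≤ ‖M - B‖ := by
    have e : M - T = ∑ i : Fin (min p q), (if i.val < r then 0 else σ i) •
        Matrix.vecMulVec (u i).ofLp (v i).ofLp := by
      rw [hM, hTe, ← Finset.sum_sub_distrib]
      refine Finset.sum_congr rfl fun i _ => ?_
      rw [← sub_smul]
      split_ifs <;> simp
    rw [e]
    refine opNorm_sum_smul_vecMulVec_le hu hv (norm_nonneg _) fun i => ?_
    split_ifs with h
    · simp
    · rw [abs_of_nonneg (hσ0 i)]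
      exact singularValue_le_opNorm_sub hu hv hσ hσ0 hM i (hB.trans (not_lt.mp h))
  have hTB : ‖T - B‖ ≤ 2 * ‖M - B‖ := by
    have : T - B = (M - B) - (M - T) := by abel
    rw [this]
    exact (norm_sub_le _ _).trans (by linarith)
  have hrk : ((T - B).rank : ℝ) ≤ 2 * r := by
    have := rank_sub_le T B
    have h2 : (T - B).rank ≤ 2 * r := by omega
    exact_mod_cast h2
  calc frobSq (T - B) ≤ (T - B).rank * ‖T - B‖ ^ 2 := frobSq_le_rank_mul _
    _ ≤ (2 * r) * (2 * ‖M - B‖) ^ 2 := by gcongr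
    _ = 8 * r * ‖M - B‖ ^ 2 := by ring

end Truncation

/-! ### The deterministic error bound -/

section PointwiseBound

open scoped Matrix.Norms.L2Operator

variable {dx dy n r : ℕ}

theorem mul_eq_zero_of_mul_self_eq_zero {p q : ℕ} {Q : Matrix (Fin p) (Fin q) ℝ}
    {S : Matrix (Fin q) (Fin q) ℝ} (hS : S.transpose = S) (h : Q * (S * S) = 0) : Q * S = 0 := by
  have : (Q * S) * (Q * S).conjTranspose = 0 := by
    rw [Matrix.conjTranspose_eq_transpose_of_trivial, Matrix.transpose_mul, hS,
      show Q * S * (S * Q.transpose) = Q * (S * S) * Q.transpose by simp only [Matrix.mul_assoc],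
      h, Matrix.zero_mul]
  exact Matrix.self_mul_conjTranspose_eq_zero.mp this

theorem posSemidef_empCov (D : Fin n → EuclideanSpace ℝ (Fin dx) × EuclideanSpace ℝ (Fin dy)) :
    (empCov D).PosSemidef := by
  have h : (featureMatrix D * (featureMatrix D).transpose).PosSemidef := by
    simpa using posSemidef_transpose_mul_self (featureMatrix D).transpose
  exact h.smul (by positivity)

/-- The square root `S` satisfies S² = XXᵀ/n, so it has the column space of `X`; this gives the two
identities. For the norm, (X†S)(X†S)ᵀ = X†X/n is 1/n times an orthogonal projection: the source of
the 1/n in the variance term. -/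
theorem empCov_sqrt_facts (hn : 0 < n)
    (D : Fin n → EuclideanSpace ℝ (Fin dx) × EuclideanSpace ℝ (Fin dy)) :
    featureMatrix D * pinv (featureMatrix D) * psdSqrt (empCov D) = psdSqrt (empCov D) ∧
    psdSqrt (empCov D) * pinv (psdSqrt (empCov D)) = featureMatrix D * pinv (featureMatrix D) ∧
    ‖pinv (featureMatrix D) * psdSqrt (empCov D)‖ ^ 2 ≤ 1 / n := by
  set X := featureMatrix D with hX
  set S := psdSqrt (empCov D) with hSdef
  have hn0 : (n : ℝ) ≠ 0 := by exact_mod_cast hn.ne'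
  obtain ⟨x1, x2, x3, x4⟩ := isMoorePenrose_pinv X
  obtain ⟨s1, s2, s3, s4⟩ := isMoorePenrose_pinv S
  have hSt : S.transpose = S := psdSqrt_transpose _
  have hSS : S * S = (1 / (n : ℝ)) • (X * X.transpose) := psdSqrt_mul_self (posSemidef_empCov D)
  have h1 : X * pinv X * S = S := by
    have : (X * pinv X - 1) * S = 0 := by
      apply mul_eq_zero_of_mul_self_eq_zero hSt
      rw [hSS, Matrix.sub_mul, Matrix.mul_smul, ← Matrix.mul_assoc, x1, Matrix.one_mul, sub_self]
    rwa [Matrix.sub_mul, Matrix.one_mul, sub_eq_zero] at this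
  have h2 : S * pinv S * X = X := by
    have hz : (S * pinv S - 1) * (X * X.transpose) = 0 := by
      have : X * X.transpose = (n : ℝ) • (S * S) := by
        rw [hSS, smul_smul, mul_one_div_cancel hn0, one_smul]
      rw [this, Matrix.sub_mul, Matrix.mul_smul, ← Matrix.mul_assoc, s1, Matrix.one_mul, sub_self]
    have : ((S * pinv S - 1) * X) * ((S * pinv S - 1) * X).conjTranspose = 0 := by
      rw [Matrix.conjTranspose_eq_transpose_of_trivial, Matrix.transpose_mul,
        ← Matrix.mul_assoc, Matrix.mul_assoc _ X, hz, Matrix.zero_mul]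
    have := Matrix.self_mul_conjTranspose_eq_zero.mp this
    rwa [Matrix.sub_mul, Matrix.one_mul, sub_eq_zero] at this
  refine ⟨h1, ?_, ?_⟩
  · have e1 : X * pinv X * (S * pinv S) = S * pinv S := by rw [← Matrix.mul_assoc, h1]
    have e2 : S * pinv S * (X * pinv X) = X * pinv X := by rw [← Matrix.mul_assoc, h2]
    rw [← s3, ← e1, Matrix.transpose_mul, s3, x3, e2]
  · have e : (pinv X * S) * (pinv X * S).transpose = (1 / (n : ℝ)) • (pinv X * X) := by
      rw [Matrix.transpose_mul, hSt]
      calc pinv X * S * (S * (pinv X).transpose) = pinv X * (S * S) * (pinv X).transpose := by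
            simp only [Matrix.mul_assoc]
        _ = (1 / (n : ℝ)) • (pinv X * X * (pinv X * X).transpose) := by
            rw [hSS, Matrix.transpose_mul, Matrix.mul_smul, Matrix.smul_mul]
            simp only [Matrix.mul_assoc]
        _ = (1 / (n : ℝ)) • (pinv X * X) := by rw [x4, ← Matrix.mul_assoc, x2]
    have hproj : ‖pinv X * X‖ ≤ 1 := opNorm_le_one_of_proj x4 (by rw [← Matrix.mul_assoc, x2])
    rw [← opNorm_transpose, ← opNorm_transpose_mul_self, Matrix.transpose_transpose, e, norm_smul,
      Real.norm_of_nonneg (by positivity)]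
    exact mul_le_of_le_one_right (by positivity) hproj

/-- The noise matrix `[ε₁, …, εₙ]` of a training set, `εᵢ = yᵢ - A⋆ xᵢ`. -/
def noiseMatrix (Astar : Matrix (Fin dy) (Fin dx) ℝ)
    (D : Fin n → EuclideanSpace ℝ (Fin dx) × EuclideanSpace ℝ (Fin dy)) :
    Matrix (Fin dy) (Fin n) ℝ :=
  colMatrix fun i => (D i).2 - Matrix.toEuclideanLin Astar (D i).1

theorem labelMatrix_eq (Astar : Matrix (Fin dy) (Fin dx) ℝ)
    (D : Fin n → EuclideanSpace ℝ (Fin dx) × EuclideanSpace ℝ (Fin dy)) :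
    labelMatrix D = Astar * featureMatrix D + noiseMatrix Astar D := by
  ext i j
  simp [labelMatrix, featureMatrix, noiseMatrix, colMatrix, Matrix.mul_apply, Matrix.mulVec,
    dotProduct]

/-- The deterministic error bound for a LoRA solution. -/
theorem frobSq_loRA_sub_le (hn : 0 < n) {A0 Astar A : Matrix (Fin dy) (Fin dx) ℝ}
    {D : Fin n → EuclideanSpace ℝ (Fin dx) × EuclideanSpace ℝ (Fin dy)}
    (hA : IsLoRASolution D r A0 A) (hrank : (Astar - A0).rank ≤ r)
    {S : Matrix (Fin dx) (Fin dx) ℝ} (hS : S.PosSemidef) :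
    frobSq ((A - Astar) * psdSqrt S) ≤
      2 * frobSq ((Astar - A0) * projPerp D * psdSqrt S) +
      16 * r / n * ‖noiseMatrix Astar D‖ ^ 2 * lambdaMax (S * pinv (empCov D)) := by
  obtain ⟨T, hT, rfl⟩ := hA
  obtain ⟨h1, h2, h3⟩ := empCov_sqrt_facts hn D
  rw [lambdaMax_mul_pinv hS (posSemidef_empCov D)]
  set R := psdSqrt (empCov D)
  set X := featureMatrix D with hX
  set E := noiseMatrix Astar D with hE
  set B := (Astar - A0) * R with hB
  -- The signal part Δ⋆ X X† R collapses to Δ⋆ R = B, leaving only noise.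
  have hM : deltaFFT D A0 * R - B = E * (pinv X * R) := by
    rw [deltaFFT, labelMatrix_eq Astar, ← hX, ← hE, hB]
    calc (Astar * X + E - A0 * X) * pinv X * R - (Astar - A0) * R
        = (Astar - A0) * (X * pinv X * R) + E * (pinv X * R) - (Astar - A0) * R := by
          simp only [Matrix.add_mul, Matrix.sub_mul, Matrix.mul_assoc]; abel
      _ = E * (pinv X * R) := by rw [h1]; abel
  have hTB : frobSq (T - B) ≤ 8 * r * (‖E‖ ^ 2 * (1 / n)) := by
    refine (frobSq_truncation_sub_le hT ((Matrix.rank_mul_le_left _ _).trans hrank)).trans ?_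
    rw [hM]
    gcongr
    calc ‖E * (pinv X * R)‖ ^ 2 ≤ (‖E‖ * ‖pinv X * R‖) ^ 2 := by
          gcongr; exact Matrix.l2_opNorm_mul _ _
      _ = ‖E‖ ^ 2 * ‖pinv X * R‖ ^ 2 := mul_pow _ _ _
      _ ≤ ‖E‖ ^ 2 * (1 / n) := by gcongr
  -- Here B R† = Δ⋆ X X†, so replacing `T` by `B` misses Δ⋆ exactly by Δ⋆ P_X^⊥.
  have hdec : (A0 + T * pinv R - Astar) * psdSqrt S =
      (T - B) * (pinv R * psdSqrt S) - (Astar - A0) * projPerp D * psdSqrt S := by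
    rw [projPerp, ← hX, ← h2, hB]
    simp only [Matrix.add_mul, Matrix.sub_mul, Matrix.mul_sub, Matrix.mul_one, Matrix.mul_assoc]
    abel
  rw [hdec]
  refine (frobSq_sub_le _ _).trans ?_
  have h4 : frobSq ((T - B) * (pinv R * psdSqrt S)) ≤
      8 * r * (‖E‖ ^ 2 * (1 / n)) * ‖pinv R * psdSqrt S‖ ^ 2 :=
    (frobSq_mul_le _ _).trans (by gcongr)
  have h5 : 16 * r / n * ‖E‖ ^ 2 * ‖pinv R * psdSqrt S‖ ^ 2 =
      2 * (8 * r * (‖E‖ ^ 2 * (1 / n)) * ‖pinv R * psdSqrt S‖ ^ 2) := by ring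
  rw [h5]
  linarith

end PointwiseBound

/-! ### Borel measurability of the bounding terms -/

section Measurability

variable {p q d dx dy n : ℕ}

instance : MeasurableSpace (Matrix (Fin p) (Fin q) ℝ) :=
  inferInstanceAs (MeasurableSpace (Fin p → Fin q → ℝ))

instance : BorelSpace (Matrix (Fin p) (Fin q) ℝ) :=
  inferInstanceAs (BorelSpace (Fin p → Fin q → ℝ))

instance : PolishSpace (Matrix (Fin p) (Fin q) ℝ) :=
  inferInstanceAs (PolishSpace (Fin p → Fin q → ℝ))

theorem isClosed_isMoorePenrose :
    IsClosed {z : Matrix (Fin p) (Fin q) ℝ × Matrix (Fin q) (Fin p) ℝ |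
      IsMoorePenrose z.1 z.2} := by
  refine IsClosed.inter ?_ (IsClosed.inter ?_ (IsClosed.inter ?_ ?_)) <;>
    exact isClosed_eq (by fun_prop) (by fun_prop)

/-- The Moore--Penrose inverse is a Borel function: its graph is closed, so this follows from the
Lusin--Souslin theorem. -/
theorem measurable_pinv :
    Measurable (pinv : Matrix (Fin p) (Fin q) ℝ → Matrix (Fin q) (Fin p) ℝ) := by
  intro s hs
  have he : pinv ⁻¹' s = Prod.fst '' ({z : Matrix (Fin p) (Fin q) ℝ × Matrix (Fin q) (Fin p) ℝ |
      IsMoorePenrose z.1 z.2} ∩ Prod.snd ⁻¹' s) := by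
    ext A
    constructor
    · exact fun hA => ⟨(A, pinv A), ⟨isMoorePenrose_pinv A, hA⟩, rfl⟩
    · rintro ⟨⟨A', B⟩, ⟨hAB, hB⟩, rfl⟩
      have : B = pinv A' := IsMoorePenrose.unique hAB (isMoorePenrose_pinv A')
      exact Set.mem_preimage.mpr (this ▸ hB)
  rw [he]
  refine (isClosed_isMoorePenrose.measurableSet.inter
    (measurable_snd hs)).image_of_measurable_injOn measurable_fst ?_
  rintro ⟨A, B⟩ ⟨hB, -⟩ ⟨A', C⟩ ⟨hC, -⟩ (rfl : A = A')
  exact Prod.ext rfl (IsMoorePenrose.unique hB hC)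

theorem continuous_frobSq : Continuous (frobSq : Matrix (Fin p) (Fin q) ℝ → ℝ) := by
  unfold frobSq
  fun_prop

/-- `(1/n) X Xᵀ` for the matrix `X` with columns `x₁, …, xₙ`. -/
def colCov (x : Fin n → EuclideanSpace ℝ (Fin d)) : Matrix (Fin d) (Fin d) ℝ :=
  (1 / (n : ℝ)) • (colMatrix x * (colMatrix x).transpose)

theorem continuous_colCov :
    Continuous (colCov : (Fin n → EuclideanSpace ℝ (Fin d)) → Matrix (Fin d) (Fin d) ℝ) := by
  have := continuous_colMatrix (d := d) (n := n)
  unfold colCov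
  fun_prop

open scoped Matrix.Norms.L2Operator in
theorem measurable_lambdaMax_mul_pinv_colCov {S : Matrix (Fin d) (Fin d) ℝ} (hS : S.PosSemidef) :
    Measurable fun x : Fin n → EuclideanSpace ℝ (Fin d) => lambdaMax (S * pinv (colCov x)) := by
  -- Features alone are viewed as a training set with labels in dimension 0. Positivity then allows
  -- the supremum over the spectrum to be replaced by a norm continuous in the pseudoinverse.
  have hpsd : ∀ x : Fin n → EuclideanSpace ℝ (Fin d), (colCov x).PosSemidef := fun x =>
    posSemidef_empCov (dy := 0) fun i => (x i, 0)
  simp only [fun x => lambdaMax_mul_pinv_eq_opNorm hS (hpsd x)]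
  have hc : Continuous fun P : Matrix (Fin d) (Fin d) ℝ => ‖psdSqrt S * P * psdSqrt S‖ := by
    fun_prop
  exact hc.measurable.comp (measurable_pinv.comp continuous_colCov.measurable)

theorem continuous_featureMatrix :
    Continuous (featureMatrix :
      (Fin n → EuclideanSpace ℝ (Fin dx) × EuclideanSpace ℝ (Fin dy)) → _) := by
  have h : Continuous fun (D : Fin n → EuclideanSpace ℝ (Fin dx) × EuclideanSpace ℝ (Fin dy))
      (i : Fin n) => (D i).1 := by fun_prop
  exact continuous_colMatrix.comp h

theorem measurable_frobSq_mul_pinv (B : Matrix (Fin dy) (Fin dx) ℝ)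
    (Q : Matrix (Fin dx) (Fin dx) ℝ) :
    Measurable fun X : Matrix (Fin dx) (Fin n) ℝ => frobSq (B * (1 - X * pinv X) * Q) := by
  have hc : Continuous fun z : Matrix (Fin dx) (Fin n) ℝ × Matrix (Fin n) (Fin dx) ℝ =>
      B * (1 - z.1 * z.2) * Q := by fun_prop
  have h1 := (continuous_frobSq.comp hc).measurable
  have h2 : Measurable fun X : Matrix (Fin dx) (Fin n) ℝ => (X, pinv X) :=
    measurable_id.prodMk measurable_pinv
  have h3 := h1.comp h2
  exact h3

theorem measurable_frobSq_projPerp (B : Matrix (Fin dy) (Fin dx) ℝ)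
    (Q : Matrix (Fin dx) (Fin dx) ℝ) :
    Measurable fun D : Fin n → EuclideanSpace ℝ (Fin dx) × EuclideanSpace ℝ (Fin dy) =>
      frobSq (B * projPerp D * Q) :=
  (measurable_frobSq_mul_pinv B Q).comp continuous_featureMatrix.measurable

end Measurability

/-! ### Second moments and the population risk -/

section Risk

open scoped RealInnerProductSpace

variable {dx dy : ℕ}

theorem integrable_coord_mul {Px : Measure (EuclideanSpace ℝ (Fin dx))} (hP : MemLp id 2 Px)
    (i j : Fin dx) : Integrable (fun x => x i * x j) Px := by
  have h : ∀ i, MemLp (fun x : EuclideanSpace ℝ (Fin dx) => x i) 2 Px := fun i =>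
    (EuclideanSpace.proj (𝕜 := ℝ) i).comp_memLp' hP
  exact (h i).integrable_mul (h j)

theorem norm_sq_toEuclideanLin (B : Matrix (Fin dy) (Fin dx) ℝ) (x : EuclideanSpace ℝ (Fin dx)) :
    ‖Matrix.toEuclideanLin B x‖ ^ 2 = ∑ a, ∑ i, ∑ j, B a i * B a j * (x i * x j) := by
  rw [EuclideanSpace.real_norm_sq_eq]
  refine Finset.sum_congr rfl fun a _ => ?_
  rw [Matrix.ofLp_toLpLin, Matrix.toLin'_apply, Matrix.mulVec, dotProduct, sq, Finset.sum_mul_sum]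
  exact Finset.sum_congr rfl fun i _ => Finset.sum_congr rfl fun j _ => by ring

theorem integral_norm_sq_toEuclideanLin {Px : Measure (EuclideanSpace ℝ (Fin dx))}
    (hP : MemLp id 2 Px) (B : Matrix (Fin dy) (Fin dx) ℝ) :
    Integrable (fun x => ‖Matrix.toEuclideanLin B x‖ ^ 2) Px ∧
    ∫ x, ‖Matrix.toEuclideanLin B x‖ ^ 2 ∂Px = (B * secondMoment Px * B.transpose).trace := by
  have hi : ∀ a i j, Integrable (fun x => B a i * B a j * (x i * x j)) Px := fun a i j =>
    (integrable_coord_mul hP i j).const_mul _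
  simp only [norm_sq_toEuclideanLin]
  constructor
  · exact integrable_finsetSum _ fun a _ => integrable_finsetSum _ fun i _ =>
      integrable_finsetSum _ fun j _ => hi a i j
  · rw [integral_finsetSum _ fun a _ => integrable_finsetSum _ fun i _ =>
      integrable_finsetSum _ fun j _ => hi a i j]
    refine Finset.sum_congr rfl fun a _ => ?_
    rw [integral_finsetSum _ fun i _ => integrable_finsetSum _ fun j _ => hi a i j,
      Matrix.diag_apply, Matrix.mul_assoc, Matrix.mul_apply]
    refine Finset.sum_congr rfl fun i _ => ?_
    rw [integral_finsetSum _ fun j _ => hi a i j, Matrix.mul_apply, Finset.mul_sum]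
    refine Finset.sum_congr rfl fun j _ => ?_
    rw [integral_const_mul, secondMoment, Matrix.of_apply, Matrix.transpose_apply]
    ring

theorem posSemidef_secondMoment {Px : Measure (EuclideanSpace ℝ (Fin dx))}
    (hP : MemLp id 2 Px) : (secondMoment Px).PosSemidef := by
  refine Matrix.PosSemidef.of_dotProduct_mulVec_nonneg ?_ fun v => ?_
  · ext i j
    simp [secondMoment, mul_comm]
  -- With `v` as the only row of a matrix, the quadratic form is the integral of a squared norm.
  · have h := (integral_norm_sq_toEuclideanLin hP (Matrix.replicateRow (Fin 1) v)).2
    have h2 : star v ⬝ᵥ (secondMoment Px).mulVec v =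
        (Matrix.replicateRow (Fin 1) v * secondMoment Px *
          (Matrix.replicateRow (Fin 1) v).transpose).trace := by
      rw [Matrix.trace_fin_one, Matrix.mul_assoc]
      simp [Matrix.mul_apply, dotProduct, Matrix.mulVec]
    rw [h2, ← h]
    exact integral_nonneg fun x => sq_nonneg _

theorem risk_sampleLaw {Px : Measure (EuclideanSpace ℝ (Fin dx))} [IsProbabilityMeasure Px]
    (Astar A : Matrix (Fin dy) (Fin dx) ℝ) (Sε : Matrix (Fin dy) (Fin dy) ℝ) :
    risk (sampleLaw Astar Px Sε) A =
      ∫⁻ x, ∫⁻ e, ENNReal.ofReal (‖Matrix.toEuclideanLin (A - Astar) x - e‖ ^ 2)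
        ∂multivariateGaussian 0 Sε ∂Px := by
  have hA : Measurable (Matrix.toEuclideanLin A) :=
    (LinearMap.continuous_of_finiteDimensional _).measurable
  have hs : Measurable (Matrix.toEuclideanLin Astar) :=
    (LinearMap.continuous_of_finiteDimensional _).measurable
  rw [risk, sampleLaw, lintegral_map (by fun_prop) (by fun_prop), lintegral_prod _ (by fun_prop)]
  simp only [map_sub, LinearMap.sub_apply, sub_sub]

/-- The bias--variance decomposition of the population risk. -/
theorem risk_eq_add {Px : Measure (EuclideanSpace ℝ (Fin dx))} [IsProbabilityMeasure Px]
    (hP : MemLp id 2 Px) (Astar A : Matrix (Fin dy) (Fin dx) ℝ) (Sε : Matrix (Fin dy) (Fin dy) ℝ) :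
    risk (sampleLaw Astar Px Sε) A = risk (sampleLaw Astar Px Sε) Astar +
      ENNReal.ofReal (frobSq ((A - Astar) * psdSqrt (secondMoment Px))) := by
  set ν := multivariateGaussian 0 Sε with hν
  have hid : Integrable (fun e => e) ν := IsGaussian.integrable_id
  have hsq : Integrable (fun e => ‖e‖ ^ 2) ν :=
    (IsGaussian.memLp_two_id (μ := ν)).norm.integrable_sq
  -- The cross term vanishes because the noise is centred. The case a = 0 handles the risk of A⋆
  -- itself.
  have hinner : ∀ a : EuclideanSpace ℝ (Fin dy), ∫⁻ e, ENNReal.ofReal (‖a - e‖ ^ 2) ∂ν =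
      ENNReal.ofReal (‖a‖ ^ 2) + ∫⁻ e, ENNReal.ofReal (‖e‖ ^ 2) ∂ν := by
    intro a
    have hai : Integrable (fun e => ⟪a, e⟫) ν := hid.const_inner a
    have hexp : ∀ e : EuclideanSpace ℝ (Fin dy),
        ‖a - e‖ ^ 2 = ‖a‖ ^ 2 - 2 * ⟪a, e⟫ + ‖e‖ ^ 2 := fun e => norm_sub_sq_real a e
    have h1 : Integrable (fun e => ‖a‖ ^ 2 - 2 * ⟪a, e⟫) ν :=
      (integrable_const _).sub (hai.const_mul 2)
    have hint : Integrable (fun e => ‖a - e‖ ^ 2) ν := by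
      simp only [hexp]
      exact h1.add hsq
    have h0 : ∫ e, ⟪a, e⟫ ∂ν = 0 := by
      rw [integral_inner hid a, hν, integral_id_multivariateGaussian, inner_zero_right]
    rw [← ofReal_integral_eq_lintegral_ofReal hint (ae_of_all _ fun e => sq_nonneg _),
      ← ofReal_integral_eq_lintegral_ofReal hsq (ae_of_all _ fun e => sq_nonneg _),
      ← ENNReal.ofReal_add (sq_nonneg _) (integral_nonneg fun e => sq_nonneg _)]
    congr 1
    simp only [hexp]
    rw [integral_add h1 hsq, integral_sub (integrable_const _) (hai.const_mul 2),
      integral_const_mul, h0]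
    simp
  obtain ⟨hBi, hB⟩ := integral_norm_sq_toEuclideanLin hP (A - Astar)
  have hfrob : frobSq ((A - Astar) * psdSqrt (secondMoment Px)) =
      ∫ x, ‖Matrix.toEuclideanLin (A - Astar) x‖ ^ 2 ∂Px := by
    rw [hB, frobSq_eq_trace, Matrix.transpose_mul, psdSqrt_transpose]
    conv_rhs => rw [← psdSqrt_mul_self (posSemidef_secondMoment hP)]
    simp only [Matrix.mul_assoc]
  rw [risk_sampleLaw, risk_sampleLaw, hfrob,
    ofReal_integral_eq_lintegral_ofReal hBi (ae_of_all _ fun x => sq_nonneg _)]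
  simp only [← hν, hinner, sub_self, map_zero, LinearMap.zero_apply, norm_zero]
  rw [lintegral_add_right _ measurable_const]
  simp [add_comm]

end Risk

/-! ### Noise with a general covariance -/

section NoiseMoment

open scoped Matrix.Norms.L2Operator

variable {d n : ℕ}

theorem continuous_opNorm_colMatrix :
    Continuous fun e : Fin n → EuclideanSpace ℝ (Fin d) => ‖colMatrix e‖ :=
  continuous_norm.comp continuous_colMatrix

theorem colMatrix_toEuclideanCLM (Q : Matrix (Fin d) (Fin d) ℝ)
    (g : Fin n → EuclideanSpace ℝ (Fin d)) :
    colMatrix (fun i => 0 + Matrix.toEuclideanCLM (𝕜 := ℝ) Q (g i)) = Q * colMatrix g := by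
  ext a i
  simp [colMatrix, Matrix.mul_apply, Matrix.mulVec, dotProduct]

theorem lintegral_opNorm_sq_multivariateGaussian_le (hn : 0 < n) {S : Matrix (Fin d) (Fin d) ℝ}
    (hS : S.PosSemidef) :
    ∫⁻ e, ENNReal.ofReal (‖colMatrix e‖ ^ 2)
      ∂Measure.pi (fun _ : Fin n => multivariateGaussian 0 S) ≤
    ENNReal.ofReal (3072 * (n + d) * lambdaMax S) := by
  -- By definition `multivariateGaussian 0 S` is the image of the standard Gaussian under this map,
  -- mean `0 +` included. The noise matrix is thus S^{1/2} G with `G` standard.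
  have hm : Measurable fun x => 0 + Matrix.toEuclideanCLM (𝕜 := ℝ) (psdSqrt S) x := by fun_prop
  have hsf : ∀ _ : Fin n, SigmaFinite ((stdGaussian (EuclideanSpace ℝ (Fin d))).map
      (fun x => 0 + Matrix.toEuclideanCLM (𝕜 := ℝ) (psdSqrt S) x)) := fun _ => by
    have := Measure.isProbabilityMeasure_map
      (μ := stdGaussian (EuclideanSpace ℝ (Fin d))) hm.aemeasurable
    infer_instance
  have hpi : Measure.pi (fun _ : Fin n => multivariateGaussian 0 S) =
      (Measure.pi fun _ : Fin n => stdGaussian (EuclideanSpace ℝ (Fin d))).map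
        (fun g i => 0 + Matrix.toEuclideanCLM (𝕜 := ℝ) (psdSqrt S) (g i)) :=
    (Measure.pi_map_pi (hμ := hsf) fun _ => hm.aemeasurable).symm
  have hf : Measurable fun e : Fin n → EuclideanSpace ℝ (Fin d) =>
      ENNReal.ofReal (‖colMatrix e‖ ^ 2) :=
    (continuous_opNorm_colMatrix.pow 2).measurable.ennreal_ofReal
  rw [hpi, lintegral_map hf (by fun_prop)]
  calc _ ≤ ∫⁻ g, ENNReal.ofReal (lambdaMax S) * ENNReal.ofReal (‖colMatrix g‖ ^ 2)
        ∂Measure.pi fun _ : Fin n => stdGaussian (EuclideanSpace ℝ (Fin d)) := by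
        refine lintegral_mono fun g => ?_
        rw [colMatrix_toEuclideanCLM, lambdaMax_eq_opNorm_psdSqrt_sq hS,
          ← ENNReal.ofReal_mul (sq_nonneg _), ← mul_pow]
        refine ENNReal.ofReal_le_ofReal (pow_le_pow_left₀ (norm_nonneg _) ?_ 2)
        exact Matrix.l2_opNorm_mul (psdSqrt S) (colMatrix g)
    _ ≤ ENNReal.ofReal (lambdaMax S) * ENNReal.ofReal (3072 * (n + d)) := by
        rw [lintegral_const_mul' _ _ ENNReal.ofReal_ne_top]
        gcongr
        exact lintegral_opNorm_sq_stdGaussian_le d n hn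
    _ = ENNReal.ofReal (3072 * (n + d) * lambdaMax S) := by
        rw [mul_comm, ← ENNReal.ofReal_mul (by positivity)]

end NoiseMoment

/-! ### Independence of features and noise in the training set -/

section TrainingLaw

variable {dx dy n : ℕ} {Ω : Type*} [MeasurableSpace Ω] {μ : Measure Ω} [IsProbabilityMeasure μ]
  {Astar : Matrix (Fin dy) (Fin dx) ℝ} {Px : Measure (EuclideanSpace ℝ (Fin dx))}
  [IsProbabilityMeasure Px] {Sε : Matrix (Fin dy) (Fin dy) ℝ}
  {D : Fin n → Ω → EuclideanSpace ℝ (Fin dx) × EuclideanSpace ℝ (Fin dy)}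

theorem measurable_toEuclideanLin (A : Matrix (Fin dy) (Fin dx) ℝ) :
    Measurable (Matrix.toEuclideanLin A) :=
  (LinearMap.continuous_of_finiteDimensional _).measurable

/-- The features and the noise vectors of an i.i.d. training set are independent. -/
theorem lintegral_features_mul_noise
    (hD : ∀ i, HasLaw (D i) (sampleLaw Astar Px Sε) μ) (hind : iIndepFun D μ)
    {f : (Fin n → EuclideanSpace ℝ (Fin dx)) → ℝ≥0∞} (hf : Measurable f)
    {g : (Fin n → EuclideanSpace ℝ (Fin dy)) → ℝ≥0∞} (hg : Measurable g) :
    ∫⁻ ω, f (fun i => (D i ω).1) *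
      g (fun i => (D i ω).2 - Matrix.toEuclideanLin Astar (D i ω).1) ∂μ =
    (∫⁻ x, f x ∂Measure.pi fun _ => Px) *
      ∫⁻ e, g e ∂Measure.pi fun _ => multivariateGaussian 0 Sε := by
  have hs := measurable_toEuclideanLin Astar
  have hmap := (iIndepFun_iff_map_fun_eq_pi_map fun i => (hD i).aemeasurable).mp hind
  simp only [(hD _).map_eq] at hmap
  -- The training law is the image under this shear, applied samplewise, of a product of independent
  -- pairs (x, ε). Subtracting A⋆x undoes the shear, and regrouping the coordinates separates
  -- features from noise.
  set φ : EuclideanSpace ℝ (Fin dx) × EuclideanSpace ℝ (Fin dy) →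
      EuclideanSpace ℝ (Fin dx) × EuclideanSpace ℝ (Fin dy) :=
    fun z => (z.1, Matrix.toEuclideanLin Astar z.1 + z.2) with hφ
  have hφm : Measurable φ := by fun_prop
  have hsf : ∀ _ : Fin n,
      SigmaFinite ((Px.prod (multivariateGaussian 0 Sε)).map φ) := fun _ => by
    have := Measure.isProbabilityMeasure_map
      (μ := Px.prod (multivariateGaussian 0 Sε)) hφm.aemeasurable
    infer_instance
  have hpi : Measure.pi (fun _ : Fin n => sampleLaw Astar Px Sε) =
      (Measure.pi fun _ : Fin n => Px.prod (multivariateGaussian 0 Sε)).map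
        (fun z i => φ (z i)) :=
    (Measure.pi_map_pi (hμ := hsf) fun _ => hφm.aemeasurable).symm
  have hF : Measurable fun z : Fin n → EuclideanSpace ℝ (Fin dx) × EuclideanSpace ℝ (Fin dy) =>
      f (fun i => (z i).1) * g (fun i => (z i).2 - Matrix.toEuclideanLin Astar (z i).1) := by
    refine (hf.comp ?_).mul (hg.comp ?_) <;> fun_prop
  have hG : Measurable fun z : (Fin n → EuclideanSpace ℝ (Fin dx)) ×
      (Fin n → EuclideanSpace ℝ (Fin dy)) => f z.1 * g z.2 :=
    (hf.comp measurable_fst).mul (hg.comp measurable_snd)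
  have hmp := measurePreserving_arrowProdEquivProdArrow (EuclideanSpace ℝ (Fin dx))
    (EuclideanSpace ℝ (Fin dy)) (Fin n) (fun _ => Px) (fun _ => multivariateGaussian 0 Sε)
  have hDm : AEMeasurable (fun ω i => D i ω) μ :=
    aemeasurable_pi_lambda _ fun i => (hD i).aemeasurable
  calc _ = ∫⁻ z, f (fun i => (z i).1) *
          g (fun i => (z i).2 - Matrix.toEuclideanLin Astar (z i).1)
          ∂μ.map (fun ω i => D i ω) := (lintegral_map' hF.aemeasurable hDm).symm
    _ = ∫⁻ z, f (fun i => (z i).1) * g (fun i => (z i).2)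
          ∂Measure.pi fun _ : Fin n => Px.prod (multivariateGaussian 0 Sε) := by
        rw [hmap, hpi, lintegral_map hF (by fun_prop)]
        simp only [hφ, add_sub_cancel_left]
    _ = ∫⁻ z, f z.1 * g z.2
          ∂(Measure.pi fun _ => Px).prod (Measure.pi fun _ => multivariateGaussian 0 Sε) :=
        hmp.lintegral_comp hG
    _ = _ := lintegral_prod_mul hf.aemeasurable hg.aemeasurable

end TrainingLaw

/-! ### Taking expectations -/

section MainBound

open scoped Matrix.Norms.L2Operator

variable {dx dy n r : ℕ} {Ω : Type*} [MeasurableSpace Ω] {μ : Measure Ω} [IsProbabilityMeasure μ]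
  {A0 Astar : Matrix (Fin dy) (Fin dx) ℝ} {Px : Measure (EuclideanSpace ℝ (Fin dx))}
  [IsProbabilityMeasure Px] {Sε : Matrix (Fin dy) (Fin dy) ℝ}
  {D : Fin n → Ω → EuclideanSpace ℝ (Fin dx) × EuclideanSpace ℝ (Fin dy)}

theorem lambdaMax_nonneg {S : Matrix (Fin dy) (Fin dy) ℝ} (hS : S.PosSemidef) :
    0 ≤ lambdaMax S := by
  rw [lambdaMax_eq_opNorm hS]
  exact norm_nonneg _

theorem lintegral_noise_mul_lambdaMax_le (hn : 0 < n) (hP : MemLp id 2 Px)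
    (hS : Sε.PosSemidef)
    (hD : ∀ i, HasLaw (D i) (sampleLaw Astar Px Sε) μ) (hind : iIndepFun D μ) :
    ∫⁻ ω, ENNReal.ofReal (lambdaMax (secondMoment Px * pinv (empCov fun i => D i ω))) *
      ENNReal.ofReal (‖noiseMatrix Astar (fun i => D i ω)‖ ^ 2) ∂μ ≤
    ENNReal.ofReal (3072 * (n + dy) * lambdaMax Sε) *
      ∫⁻ ω, ENNReal.ofReal (lambdaMax (secondMoment Px * pinv (empCov fun i => D i ω))) ∂μ := by
  have hf : Measurable fun x : Fin n → EuclideanSpace ℝ (Fin dx) =>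
      ENNReal.ofReal (lambdaMax (secondMoment Px * pinv (colCov x))) :=
    (measurable_lambdaMax_mul_pinv_colCov (posSemidef_secondMoment hP)).ennreal_ofReal
  have hg : Measurable fun e : Fin n → EuclideanSpace ℝ (Fin dy) =>
      ENNReal.ofReal (‖colMatrix e‖ ^ 2) :=
    (continuous_opNorm_colMatrix.pow 2).measurable.ennreal_ofReal
  have h1 := lintegral_features_mul_noise hD hind hf hg
  -- The choice g = 1 rewrites the feature integral as an expectation over the training set.
  have h2 := lintegral_features_mul_noise hD hind hf (measurable_const (a := (1 : ℝ≥0∞)))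
  simp only [mul_one, lintegral_const, measure_univ] at h2
  have h3 : ∀ ω, empCov (fun i => D i ω) = colCov fun i => (D i ω).1 := fun ω => rfl
  have h4 : ∀ ω, noiseMatrix Astar (fun i => D i ω) =
      colMatrix fun i => (D i ω).2 - Matrix.toEuclideanLin Astar (D i ω).1 := fun ω => rfl
  simp only [h3, h4]
  rw [h1, h2, mul_comm]
  gcongr
  exact lintegral_opNorm_sq_multivariateGaussian_le hn hS

theorem expectedExcessRisk_loRA_le (hn : 0 < n) (hP : MemLp id 2 Px) (hS : Sε.PosSemidef)
    {Ahat : Ω → Matrix (Fin dy) (Fin dx) ℝ}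
    (hD : ∀ i, HasLaw (D i) (sampleLaw Astar Px Sε) μ) (hind : iIndepFun D μ)
    (hA : ∀ᵐ ω ∂μ, IsLoRASolution (fun i => D i ω) r A0 (Ahat ω))
    (hrank : (Astar - A0).rank ≤ r) :
    expectedExcessRisk μ (sampleLaw Astar Px Sε) Astar Ahat ≤
      ENNReal.ofReal 2 * (∫⁻ ω, ENNReal.ofReal (frobSq ((Astar - A0) *
        projPerp (fun i => D i ω) * psdSqrt (secondMoment Px))) ∂μ) +
      ENNReal.ofReal (16 * r / n) * (ENNReal.ofReal (3072 * (n + dy) * lambdaMax Sε) *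
        ∫⁻ ω, ENNReal.ofReal (lambdaMax (secondMoment Px *
          pinv (empCov fun i => D i ω))) ∂μ) := by
  have hDm : AEMeasurable (fun ω i => D i ω) μ :=
    aemeasurable_pi_lambda _ fun i => (hD i).aemeasurable
  have hS2 := posSemidef_secondMoment hP
  rw [expectedExcessRisk, tsub_le_iff_left]
  calc ∫⁻ ω, risk (sampleLaw Astar Px Sε) (Ahat ω) ∂μ
      ≤ ∫⁻ ω, (risk (sampleLaw Astar Px Sε) Astar +
          (ENNReal.ofReal 2 * ENNReal.ofReal (frobSq ((Astar - A0) *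
            projPerp (fun i => D i ω) * psdSqrt (secondMoment Px))) +
          ENNReal.ofReal (16 * r / n) *
            (ENNReal.ofReal (lambdaMax (secondMoment Px * pinv (empCov fun i => D i ω))) *
            ENNReal.ofReal (‖noiseMatrix Astar (fun i => D i ω)‖ ^ 2)))) ∂μ := by
        -- Monotonicity needs no measurability of `Ahat`, whose choice of truncation is arbitrary;
        -- only the bounding terms must be measurable for the sum to be split.
        refine lintegral_mono_ae ?_
        filter_upwards [hA] with ω hω
        rw [risk_eq_add hP]
        gcongr
        have hl : 0 ≤ lambdaMax (secondMoment Px * pinv (empCov fun i => D i ω)) := by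
          rw [lambdaMax_mul_pinv hS2 (posSemidef_empCov _)]
          positivity
        have hfr := frobSq_nonneg
          ((Astar - A0) * projPerp (fun i => D i ω) * psdSqrt (secondMoment Px))
        rw [← ENNReal.ofReal_mul zero_le_two, ← ENNReal.ofReal_mul hl,
          ← ENNReal.ofReal_mul (by positivity), ← ENNReal.ofReal_add (by positivity)
            (by positivity)]
        refine ENNReal.ofReal_le_ofReal ((frobSq_loRA_sub_le hn hω hrank hS2).trans_eq ?_)
        ring
    _ = risk (sampleLaw Astar Px Sε) Astar +
          (ENNReal.ofReal 2 * (∫⁻ ω, ENNReal.ofReal (frobSq ((Astar - A0) *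
            projPerp (fun i => D i ω) * psdSqrt (secondMoment Px))) ∂μ) +
          ENNReal.ofReal (16 * r / n) *
            ∫⁻ ω, ENNReal.ofReal (lambdaMax (secondMoment Px * pinv (empCov fun i => D i ω))) *
            ENNReal.ofReal (‖noiseMatrix Astar (fun i => D i ω)‖ ^ 2) ∂μ) := by
        have hm : AEMeasurable (fun ω => ENNReal.ofReal 2 * ENNReal.ofReal (frobSq ((Astar - A0) *
            projPerp (fun i => D i ω) * psdSqrt (secondMoment Px)))) μ :=
          ((measurable_frobSq_projPerp (n := n) (Astar - A0)
            (psdSqrt (secondMoment Px))).ennreal_ofReal.comp_aemeasurable hDm).const_mul _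
        rw [lintegral_add_left measurable_const, lintegral_const, measure_univ, mul_one,
          lintegral_add_left' hm, lintegral_const_mul' _ _ ENNReal.ofReal_ne_top,
          lintegral_const_mul' _ _ ENNReal.ofReal_ne_top]
    _ ≤ _ := by
        gcongr
        exact lintegral_noise_mul_lambdaMax_le hn hP hS hD hind

end MainBound

end LoRA

end

/-! ### The theorem with an explicit constant -/

theorem mainTheorem4 :
    ∃ C : ℝ≥0,
      ∀ (dx dy n r : ℕ)
        (A0 Astar : Matrix (Fin dy) (Fin dx) ℝ)
        (Px : Measure (EuclideanSpace ℝ (Fin dx))) [IsProbabilityMeasure Px]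
        (Sε : Matrix (Fin dy) (Fin dy) ℝ)
        (Ω : Type*) [MeasurableSpace Ω] (μ : Measure Ω) [IsProbabilityMeasure μ]
        (D : Fin n → Ω → EuclideanSpace ℝ (Fin dx) × EuclideanSpace ℝ (Fin dy))
        (Ahat : Ω → Matrix (Fin dy) (Fin dx) ℝ),
        MemLp id 2 Px →
        (LoRA.secondMoment Px).rank = dx →
        Sε.PosSemidef →
        (∀ i, HasLaw (D i) (LoRA.sampleLaw Astar Px Sε) μ) →
        iIndepFun D μ →
        (∀ᵐ ω ∂μ, LoRA.IsLoRASolution (fun i => D i ω) r A0 (Ahat ω)) →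
        (Astar - A0).rank ≤ r → r < n → n < dx →
        LoRA.expectedExcessRisk μ (LoRA.sampleLaw Astar Px Sε) Astar Ahat ≤
          C * ((∫⁻ ω, ENNReal.ofReal (LoRA.frobSq ((Astar - A0) *
                  LoRA.projPerp (fun i => D i ω) * LoRA.psdSqrt (LoRA.secondMoment Px))) ∂μ) +
            ENNReal.ofReal ((r : ℝ) * max (n : ℝ) (dy : ℝ) / (n : ℝ) * LoRA.lambdaMax Sε) *
              ∫⁻ ω, ENNReal.ofReal (LoRA.lambdaMax (LoRA.secondMoment Px *
                LoRA.pinv (LoRA.empCov fun i => D i ω))) ∂μ) := by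
  -- 98304 = 16 · 3072 · 2: the deterministic bound, the Gaussian moment bound, and n + d_y ≤ 2
  -- max(n, d_y). It also dominates the factor 2 of the bias term.
  refine ⟨98304, ?_⟩
  intro dx dy n r A0 Astar Px _ Sε Ω _ μ _ D Ahat hP _ hS hD hind hA hrank hrn _
  have hn : 0 < n := (Nat.zero_le r).trans_lt hrn
  refine (LoRA.expectedExcessRisk_loRA_le hn hP hS hD hind hA hrank).trans ?_
  rw [mul_add (_ : ℝ≥0∞), ← mul_assoc, ← mul_assoc]
  have h2 : ENNReal.ofReal 2 ≤ ((98304 : ℝ≥0) : ℝ≥0∞) := by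
    rw [← ENNReal.ofReal_coe_nnreal]
    exact ENNReal.ofReal_le_ofReal (by norm_num)
  refine add_le_add (mul_le_mul_left h2 _) (mul_le_mul_left ?_ _)
  have hl := LoRA.lambdaMax_nonneg hS
  rw [← ENNReal.ofReal_coe_nnreal, ← ENNReal.ofReal_mul (by positivity),
    ← ENNReal.ofReal_mul (by positivity)]
  refine ENNReal.ofReal_le_ofReal ?_
  have hsum : (n : ℝ) + dy ≤ 2 * max (n : ℝ) dy := by
    linarith [le_max_left (n : ℝ) dy, le_max_right (n : ℝ) dy]
  calc 16 * (r : ℝ) / n * (3072 * (n + dy) * LoRA.lambdaMax Sε)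
      ≤ 16 * (r : ℝ) / n * (3072 * (2 * max (n : ℝ) dy) * LoRA.lambdaMax Sε) := by gcongr
    _ = ((98304 : ℝ≥0) : ℝ) * (r * max (n : ℝ) dy / n * LoRA.lambdaMax Sε) := by
        push_cast
        ring
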